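/- Let $M$ be a connected, oriented smooth manifold (Hausdorff, second countable) of dimension $n\ge 2$, let $A\subseteq TM$ be open and conic ($\lambda v\in A$ for $v\in A$, $\lambda>0$) with $\pi(A)=M$, where $\pi\colon TM\to M$ is the projection. An $A$-anisotropic function, vector field or $s$-form assigns smoothly to each $v\in A$ a real number, a vector of $T_{\pi(v)}M$, or an alternating $s$-form on $T_{\pi(v)}M$, respectively. Every chart $(x^i)$ of $M$ induces coordinates $(x^i,y^i)$ on $TM$. Let $L\colon A\to\mathbb R$ be a pseudo-Finsler metric: smooth, positively $2$-homogeneous, with nondegenerate $g_{ij}=\frac12\frac{\partial^2L}{\partial y^i\partial y^j}$. Put $C_{ijk}=\frac12\frac{\partial g_{ij}}{\partial y^k}$ and $\gamma^i_{jk}=\frac12g^{ic}\left(\frac{\partial g_{cj}}{\partial x^k}+\frac{\partial g_{ck}}{\partial x^j}-\frac{\partial g_{jk}}{\partial x^c}\right)$. The metric nonlinear connection of $L$ has coefficients $N^i_j=\gamma^i_{jk}y^k-g^{il}C_{ljk}\gamma^k_{ab}y^ay^b$; let $\delta_i=\frac{\partial}{\partial x^i}-N^j_i\frac{\partial}{\partial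 y^j}$. The metric volume form is $d\mathrm{Vol}=\sqrt{|\det g_{ab}|}\,dx^1\wedge\dots\wedge dx^n$ in positively oriented charts. For anisotropic vector fields $Z,X$ put $\mathfrak l^H_ZX=(Z^j\delta_jX^i-X^j\delta_jZ^i)\partial_i$, and for an anisotropic $s$-form $\omega$ put $$\mathfrak l^H_Z\omega(X_1,\dots,X_s)=Z^k\delta_k\big(\omega(X_1,\dots,X_s)\big)-\sum_\nu\omega(X_1,\dots,\mathfrak l^H_ZX_\nu,\dots,X_s).$$ The divergence $\mathrm{div}(Z)$ is the smooth anisotropic function given by $\mathfrak l^H_Z(d\mathrm{Vol})=\mathrm{div}(Z)\,d\mathrm{Vol}$; it is well defined. An $A$-anisotropic connection is an operator $\nabla\colon\mathfrak X(M)\times\mathfrak X(M)\to\mathfrak X(M_A)$ (from pairs of vector fields on $M$ to anisotropic vector fields) that is additive in both arguments, $C^\infty(M)$-linear in the first one and satisfies $\nabla_X(fY)=X(f)Y+f\nabla_XY$. Its Christoffel symbols are given by $\nabla_{\partial_j}\partial_k=\Gamma^i_{jk}\partial_i$, its underlying nonlinear connection has coefficients $\Gamma^i_{jk}y^k$, and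 $\nabla$ is symmetric if $\nabla_XY-\nabla_YX=[X,Y]$ for all $X,Y\in\mathfrak X(M)$. With the $\delta_i$ of the underlying nonlinear connection, it acts on anisotropic vector fields by $\nabla_jZ^i=\delta_jZ^i+\Gamma^i_{jk}Z^k$ and on anisotropic forms by the Leibniz rule, with $\nabla_Z=Z^k\delta_k$ on functions. **Proposition.** Let $Z$ be an $A$-anisotropic vector field. (1) If $\nabla$ is any symmetric $A$-anisotropic connection whose underlying nonlinear connection is the metric one and such that $\nabla_Z(d\mathrm{Vol})=0$, then on $A$ $$\mathrm{div}(Z)=\mathrm{trace}(\nabla Z),\qquad\text{that is, in every chart,}\qquad \mathrm{div}(Z)=\delta_iZ^i+\Gamma^i_{ik}Z^k .$$ (2) In particular this holds for the Chern anisotropic connection of $L$, which is the $A$-anisotropic connection with the Christoffel symbols $\Gamma^i_{jk}=\frac12g^{il}(\delta_kg_{lj}+\delta_jg_{lk}-\delta_lg_{jk})$ in every chart: it satisfies the hypotheses of (1), so $\mathrm{div}(Z)=\mathrm{trace}(\nabla Z)$ for it, and one can take these symbols in the coordinate formula. -/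

import Mathlib

open scoped Manifold ContDiff Topology

noncomputable section

namespace AnisotropicFinsler

/-- Charts of `M` (not yet assumed to be smooth) with values in `ℝⁿ`. -/
abbrev Chart (n : ℕ) (M : Type*) [TopologicalSpace M] :=
  OpenPartialHomeomorph M (EuclideanSpace ℝ (Fin n))

section Basic

variable {n : ℕ} {M : Type*} [TopologicalSpace M] [ChartedSpace (EuclideanSpace ℝ (Fin n)) M]
  [IsManifold (𝓡 n) ∞ M]

/-! ### Coordinates on `M` and on `TM` -/

/-- The differential at `p` of a chart `e = (x¹, …, xⁿ)`, so that `dchart e p u i = dxⁱ(u)`. -/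
def dchart (e : Chart n M) (p : M) :
    TangentSpace (𝓡 n) p →L[ℝ] EuclideanSpace ℝ (Fin n) :=
  mfderiv (𝓡 n) (𝓡 n) e p

/-- The vector field on the domain of `e` with constant components `c`. -/
def constField (e : Chart n M) (c : EuclideanSpace ℝ (Fin n)) (p : M) :
    TangentSpace (𝓡 n) p :=
  (dchart e p).inverse c

/-- The coordinate vector field `∂ᵢ` of `e`. -/
def coordVec (e : Chart n M) (i : Fin n) (p : M) : TangentSpace (𝓡 n) p :=
  constField e (EuclideanSpace.single i 1) p

/-- The natural coordinates `(x, y)` of `v ∈ TM` associated with the chart `e`. -/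
def coord (e : Chart n M) (v : TangentBundle (𝓡 n) M) :
    EuclideanSpace ℝ (Fin n) × EuclideanSpace ℝ (Fin n) :=
  (e v.proj, dchart e v.proj v.2)

/-- The tangent vector with natural coordinates `(x, y)`. -/
def param (e : Chart n M)
    (z : EuclideanSpace ℝ (Fin n) × EuclideanSpace ℝ (Fin n)) : TangentBundle (𝓡 n) M :=
  ⟨e.symm z.1, constField e z.2 (e.symm z.1)⟩

/-- `∂f/∂xᵏ` at `v`, for a function `f` on (an open subset of) `TM`. -/
def partialX (e : Chart n M) (k : Fin n) (f : TangentBundle (𝓡 n) M → ℝ)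
    (v : TangentBundle (𝓡 n) M) : ℝ :=
  fderiv ℝ (fun z => f (param e z)) (coord e v) (EuclideanSpace.single k 1, 0)

/-- `∂f/∂yᵏ` at `v`. -/
def partialY (e : Chart n M) (k : Fin n) (f : TangentBundle (𝓡 n) M → ℝ)
    (v : TangentBundle (𝓡 n) M) : ℝ :=
  fderiv ℝ (fun z => f (param e z)) (coord e v) (0, EuclideanSpace.single k 1)

/-- `δf/δxᵏ = ∂f/∂xᵏ - Nʲₖ ∂f/∂yʲ` at `v`, for the nonlinear connection whose coefficients in the
chart `e` are `N v i j = Nⁱⱼ(v)`. -/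
def delta (e : Chart n M) (N : TangentBundle (𝓡 n) M → Fin n → Fin n → ℝ) (k : Fin n)
    (f : TangentBundle (𝓡 n) M → ℝ) (v : TangentBundle (𝓡 n) M) : ℝ :=
  partialX e k f v - ∑ j, N v j k * partialY e j f v

/-! ### Anisotropic objects

Anisotropic objects are represented by functions on the whole of `TM`, of which only the values on
the open set `A` matter. -/

/-- Smooth (isotropic) vector fields: `X ∈ 𝔛(M)`. -/
def IsVectorField (X : ∀ p : M, TangentSpace (𝓡 n) p) : Prop :=
  ContMDiff (𝓡 n) (𝓡 n).tangent ∞ (fun p => (⟨p, X p⟩ : TangentBundle (𝓡 n) M))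

/-- Smooth anisotropic functions: `f ∈ 𝓕(A)`. -/
def IsAnisoFunction (A : Set (TangentBundle (𝓡 n) M)) (f : TangentBundle (𝓡 n) M → ℝ) : Prop :=
  ContMDiffOn (𝓡 n).tangent 𝓘(ℝ, ℝ) ∞ f A

/-- Smooth anisotropic vector fields: `Z ∈ 𝔛(M_A)`. -/
def IsAnisoVectorField (A : Set (TangentBundle (𝓡 n) M))
    (Z : ∀ v : TangentBundle (𝓡 n) M, TangentSpace (𝓡 n) v.proj) : Prop :=
  ContMDiffOn (𝓡 n).tangent (𝓡 n).tangent ∞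
    (fun v => (⟨v.proj, Z v⟩ : TangentBundle (𝓡 n) M)) A

/-- The component `Zⁱ` in the chart `e` of an anisotropic vector field `Z`. -/
def comp (e : Chart n M) (Z : ∀ v : TangentBundle (𝓡 n) M, TangentSpace (𝓡 n) v.proj)
    (i : Fin n) (v : TangentBundle (𝓡 n) M) : ℝ :=
  dchart e v.proj (Z v) i

/-- The component `yⁱ` of `v` in the chart `e`. -/
def fib (e : Chart n M) (v : TangentBundle (𝓡 n) M) (i : Fin n) : ℝ :=
  dchart e v.proj v.2 i

/-- Admissible domains: open conic subsets of `TM` projecting onto `M`. -/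
structure IsConicDomain (A : Set (TangentBundle (𝓡 n) M)) : Prop where
  isOpen : IsOpen A
  conic : ∀ v ∈ A, ∀ c : ℝ, 0 < c → (⟨v.proj, c • v.2⟩ : TangentBundle (𝓡 n) M) ∈ A
  surj : ∀ p : M, ∃ v ∈ A, v.proj = p

/-! ### Anisotropic Lie bracket -/

/-- The anisotropic Lie bracket `𝔩_Z X = (Zʲ δⱼXⁱ - Xʲ δⱼZⁱ) ∂ᵢ` of anisotropic vector fields. -/
def lieVec (e : Chart n M) (N : TangentBundle (𝓡 n) M → Fin n → Fin n → ℝ)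
    (Z X : ∀ v : TangentBundle (𝓡 n) M, TangentSpace (𝓡 n) v.proj)
    (v : TangentBundle (𝓡 n) M) : TangentSpace (𝓡 n) v.proj :=
  ∑ i, (∑ j, (comp e Z j v * delta e N j (comp e X i) v
      - comp e X j v * delta e N j (comp e Z i) v)) • coordVec e i v.proj

/-- The extension of `u ∈ T_pM` (with `p = π(v)`) to the isotropic vector field having constant
components in the chart `e`. -/
def extend (e : Chart n M) (v : TangentBundle (𝓡 n) M) (u : TangentSpace (𝓡 n) v.proj) :
    ∀ v' : TangentBundle (𝓡 n) M, TangentSpace (𝓡 n) v'.proj :=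
  fun v' => constField e (dchart e v.proj u) v'.proj

/-- The anisotropic Lie bracket of `Z` with an anisotropic `s`-form `η`, evaluated at `v` on tangent
vectors `w₁, …, w_s`:
`Z^H(η(W₁, …, W_s)) - ∑ η(W₁, …, 𝔩_Z W_ν, …, W_s)`,
where `W_ν` extends `w_ν` with constant components in the chart `e`. -/
def lieForm (e : Chart n M) (N : TangentBundle (𝓡 n) M → Fin n → Fin n → ℝ)
    (Z : ∀ v : TangentBundle (𝓡 n) M, TangentSpace (𝓡 n) v.proj) {s : ℕ}
    (η : ∀ v : TangentBundle (𝓡 n) M, TangentSpace (𝓡 n) v.proj [⋀^Fin s]→ₗ[ℝ] ℝ)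
    (v : TangentBundle (𝓡 n) M) (w : Fin s → TangentSpace (𝓡 n) v.proj) : ℝ :=
  ∑ k, comp e Z k v * delta e N k (fun v' => η v' (fun ν => extend e v (w ν) v')) v
    - ∑ ν, η v (Function.update w ν (lieVec e N Z (extend e v (w ν)) v))

/-! ### Pseudo-Finsler metrics -/

/-- The fundamental tensor `g_v(u, w) = ½ ∂²/∂s∂t L(v + s u + t w)` at `s = t = 0`. -/
def fundTensor (L : TangentBundle (𝓡 n) M → ℝ) (v : TangentBundle (𝓡 n) M)
    (u w : TangentSpace (𝓡 n) v.proj) : ℝ :=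
  1 / 2 * deriv (fun s : ℝ => deriv (fun t : ℝ => L ⟨v.proj, v.2 + s • u + t • w⟩) 0) 0

/-- Pseudo-Finsler metrics on `A`: smooth positively `2`-homogeneous functions with nondegenerate
fundamental tensor. -/
structure IsPseudoFinsler (A : Set (TangentBundle (𝓡 n) M)) (L : TangentBundle (𝓡 n) M → ℝ) :
    Prop where
  smooth : IsAnisoFunction A L
  homogeneous : ∀ v ∈ A, ∀ c : ℝ, 0 < c → L ⟨v.proj, c • v.2⟩ = c ^ 2 * L v
  nondegenerate : ∀ v ∈ A, ∀ u : TangentSpace (𝓡 n) v.proj,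
    (∀ w : TangentSpace (𝓡 n) v.proj, fundTensor L v u w = 0) → u = 0

/-- The matrix `g_{ij}` in the chart `e`. -/
def gMat (L : TangentBundle (𝓡 n) M → ℝ) (e : Chart n M) (v : TangentBundle (𝓡 n) M) :
    Matrix (Fin n) (Fin n) ℝ :=
  Matrix.of fun i j => fundTensor L v (coordVec e i v.proj) (coordVec e j v.proj)

/-- The Cartan tensor `C_{ijk} = ½ ∂g_{ij}/∂yᵏ`. -/
def cartan (L : TangentBundle (𝓡 n) M → ℝ) (e : Chart n M) (v : TangentBundle (𝓡 n) M)
    (i j k : Fin n) : ℝ :=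
  1 / 2 * partialY e k (fun v' => gMat L e v' i j) v

/-- The formal Christoffel symbols
`γⁱ_{jk} = ½ g^{ic} (∂g_{cj}/∂xᵏ + ∂g_{ck}/∂xʲ - ∂g_{jk}/∂xᶜ)`. -/
def formalChristoffel (L : TangentBundle (𝓡 n) M → ℝ) (e : Chart n M)
    (v : TangentBundle (𝓡 n) M) (i j k : Fin n) : ℝ :=
  1 / 2 * ∑ c, (gMat L e v)⁻¹ i c *
    (partialX e k (fun v' => gMat L e v' c j) v + partialX e j (fun v' => gMat L e v' c k) v
      - partialX e c (fun v' => gMat L e v' j k) v)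

/-- The coefficients `Nⁱⱼ = γⁱ_{jk} yᵏ - Cⁱ_{jk} γᵏ_{ab} yᵃ yᵇ` of the metric nonlinear
connection. -/
def metricCoeff (L : TangentBundle (𝓡 n) M → ℝ) (e : Chart n M) (v : TangentBundle (𝓡 n) M)
    (i j : Fin n) : ℝ :=
  ∑ k, formalChristoffel L e v i j k * fib e v k
    - ∑ k, ∑ a, ∑ b, (∑ l, (gMat L e v)⁻¹ i l * cartan L e v l j k) *
        formalChristoffel L e v k a b * fib e v a * fib e v b

/-- The Chern symbols `Γⁱ_{jk} = ½ g^{il} (δg_{lj}/δxᵏ + δg_{lk}/δxʲ - δg_{jk}/δxˡ)`, with the `δᵢ`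
of the metric nonlinear connection. -/
def chernSymbol (L : TangentBundle (𝓡 n) M → ℝ) (e : Chart n M) (v : TangentBundle (𝓡 n) M)
    (i j k : Fin n) : ℝ :=
  1 / 2 * ∑ l, (gMat L e v)⁻¹ i l *
    (delta e (metricCoeff L e) k (fun v' => gMat L e v' l j) v
      + delta e (metricCoeff L e) j (fun v' => gMat L e v' l k) v
      - delta e (metricCoeff L e) l (fun v' => gMat L e v' j k) v)

/-! ### Orientation, metric volume form and divergence -/

variable (n M) in
/-- An orientation of `M`, given by an oriented smooth atlas. -/
structure OrientedAtlas where
  /-- The charts of the atlas; they are positively oriented by definition. -/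
  charts : Set (Chart n M)
  smooth : charts ⊆ IsManifold.maximalAtlas (𝓡 n) ∞ M
  cover : ∀ p : M, ∃ e ∈ charts, p ∈ e.source
  compatible : ∀ e ∈ charts, ∀ e' ∈ charts, ∀ p ∈ e.source ∩ e'.source,
    0 < ((dchart e' p).comp (dchart e p).inverse).det

/-- A positively oriented chart around `p`. -/
def OrientedAtlas.chart (o : OrientedAtlas n M) (p : M) : Chart n M :=
  (o.cover p).choose

/-- The components of tangent vectors at `p` in the chart `e`, as a linear map. -/
def components (e : Chart n M) (p : M) : TangentSpace (𝓡 n) p →ₗ[ℝ] (Fin n → ℝ) :=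
  LinearMap.pi fun i => ((EuclideanSpace.proj i : EuclideanSpace ℝ (Fin n) →L[ℝ] ℝ).comp
    (dchart e p)).toLinearMap

/-- The `n`-form `√|det g_{ab}(v)| dx¹ ∧ … ∧ dxⁿ` written in the chart `e`. -/
def chartVolume (L : TangentBundle (𝓡 n) M → ℝ) (e : Chart n M) (v : TangentBundle (𝓡 n) M) :
    TangentSpace (𝓡 n) v.proj [⋀^Fin n]→ₗ[ℝ] ℝ :=
  √|(gMat L e v).det| •
    (Matrix.detRowAlternating (n := Fin n) (R := ℝ)).compLinearMap (components e v.proj)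

/-- The metric volume form `dVol` of `L`: it is `√|det g_{ab}| dx¹ ∧ … ∧ dxⁿ` in positively oriented
charts. -/
def volumeForm (o : OrientedAtlas n M) (L : TangentBundle (𝓡 n) M → ℝ)
    (v : TangentBundle (𝓡 n) M) : TangentSpace (𝓡 n) v.proj [⋀^Fin n]→ₗ[ℝ] ℝ :=
  chartVolume L (o.chart v.proj) v

/-- The divergence of `Z` with respect to `L`: the factor in `𝔩_Z(dVol) = div(Z) dVol`, where `𝔩_Z` is
taken with respect to the metric nonlinear connection. At `v` the factor is read off by evaluating on
the coordinate frame of the preferred chart around `π(v)`. -/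
def divergence (o : OrientedAtlas n M) (L : TangentBundle (𝓡 n) M → ℝ)
    (Z : ∀ v : TangentBundle (𝓡 n) M, TangentSpace (𝓡 n) v.proj)
    (v : TangentBundle (𝓡 n) M) : ℝ :=
  let e : Chart n M := chartAt (EuclideanSpace ℝ (Fin n)) v.proj
  lieForm e (metricCoeff L e) Z (volumeForm o L) v (fun i => coordVec e i v.proj)
    / volumeForm o L v (fun i => coordVec e i v.proj)

/-! ### Anisotropic connections -/

/-- The derivative `u(f)` of a function `f` on `M` along `u ∈ T_pM`. -/
def dirDeriv (f : M → ℝ) (p : M) (u : TangentSpace (𝓡 n) p) : ℝ :=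
  mfderiv (𝓡 n) 𝓘(ℝ, ℝ) f p u

/-- `A`-anisotropic connections: operators `𝔛(M) × 𝔛(M) → 𝔛(M_A)`, `(X, Y) ↦ D X Y = ∇_X Y`,
satisfying the Koszul rules. -/
structure IsAnisoConnection (A : Set (TangentBundle (𝓡 n) M))
    (D : (∀ p : M, TangentSpace (𝓡 n) p) → (∀ p : M, TangentSpace (𝓡 n) p) →
      ∀ v : TangentBundle (𝓡 n) M, TangentSpace (𝓡 n) v.proj) : Prop where
  smooth : ∀ X Y, IsVectorField X → IsVectorField Y → IsAnisoVectorField A (D X Y)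
  add_left : ∀ X X' Y, IsVectorField X → IsVectorField X' → IsVectorField Y →
    ∀ v ∈ A, D (fun p => X p + X' p) Y v = D X Y v + D X' Y v
  smul_left : ∀ (f : M → ℝ) X Y, ContMDiff (𝓡 n) 𝓘(ℝ, ℝ) ∞ f → IsVectorField X →
    IsVectorField Y → ∀ v ∈ A, D (fun p => f p • X p) Y v = f v.proj • D X Y v
  add_right : ∀ X Y Y', IsVectorField X → IsVectorField Y → IsVectorField Y' →
    ∀ v ∈ A, D X (fun p => Y p + Y' p) v = D X Y v + D X Y' v
  leibniz : ∀ (f : M → ℝ) X Y, ContMDiff (𝓡 n) 𝓘(ℝ, ℝ) ∞ f → IsVectorField X →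
    IsVectorField Y → ∀ v ∈ A, D X (fun p => f p • Y p) v
      = dirDeriv f v.proj (X v.proj) • Y v.proj + f v.proj • D X Y v

/-- Symmetric (torsion-free) anisotropic connections. -/
def IsSymmetric (A : Set (TangentBundle (𝓡 n) M))
    (D : (∀ p : M, TangentSpace (𝓡 n) p) → (∀ p : M, TangentSpace (𝓡 n) p) →
      ∀ v : TangentBundle (𝓡 n) M, TangentSpace (𝓡 n) v.proj) : Prop :=
  ∀ X Y, IsVectorField X → IsVectorField Y → ∀ v ∈ A,
    D X Y v - D Y X v - VectorField.mlieBracket (𝓡 n) X Y v.proj = 0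

theorem isInvertible_dchart {e : Chart n M} (he : e ∈ IsManifold.maximalAtlas (𝓡 n) ∞ M) {p : M}
    (hp : p ∈ e.source) : (dchart e p).IsInvertible := by
  have he1 : e ∈ IsManifold.maximalAtlas (𝓡 n) 1 M :=
    IsManifold.maximalAtlas_subset_of_le (by norm_cast) he
  have hd : e.MDifferentiable (𝓡 n) (𝓡 n) :=
    ⟨fun x hx => (mdifferentiableAt_of_mem_maximalAtlas he1 hx).mdifferentiableWithinAt,
      fun x hx => (mdifferentiableAt_symm_of_mem_maximalAtlas he1 hx).mdifferentiableWithinAt⟩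
  exact ⟨hd.mfderiv hp, rfl⟩

/-- Coordinate vector fields extend to global vector fields, after shrinking the domain. -/
theorem exists_globalCoordVec [T2Space M] {e : Chart n M}
    (he : e ∈ IsManifold.maximalAtlas (𝓡 n) ∞ M) {p : M} (hp : p ∈ e.source) (i : Fin n) :
    ∃ X : ∀ q : M, TangentSpace (𝓡 n) q,
      IsVectorField X ∧ ∀ᶠ q in 𝓝 p, X q = coordVec e i q := by
  obtain ⟨ρ, -, hρ⟩ := (SmoothBumpFunction.nhds_basis_tsupport (I := 𝓡 n) p).mem_iff.1
    (e.open_source.mem_nhds hp)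
  refine ⟨(ρ : M → ℝ) • coordVec e i, ?_, ?_⟩
  · refine ContMDiffOn.smul_section_of_tsupport (u := e.source) ρ.contMDiff.contMDiffOn
      e.open_source hρ fun q hq => ContMDiffAt.contMDiffWithinAt ?_
    refine ContMDiffAt.mpullback_vectorField_preimage (n := ∞) (f := e)
      (V := fun _ => EuclideanSpace.single i (1 : ℝ)) ?_
      (contMDiffAt_of_mem_maximalAtlas he hq) (isInvertible_dchart he hq) (by norm_cast)
    exact contMDiffAt_vectorSpace_iff_contDiffAt.2 contDiffAt_const
  · filter_upwards [ρ.eventuallyEq_one] with q hq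
    simp [hq]

/-- A global vector field that agrees with `∂ᵢ` near `p` (anisotropic connections are local, so it
does not matter which one; existence is `exists_globalCoordVec`). -/
def globalCoordVec (e : Chart n M) (p : M) (i : Fin n) : ∀ q : M, TangentSpace (𝓡 n) q :=
  Classical.epsilon fun X => IsVectorField X ∧ ∀ᶠ q in 𝓝 p, X q = coordVec e i q

/-- The Christoffel symbols of an anisotropic connection: `∇_{∂ⱼ} ∂ₖ = Γⁱ_{jk} ∂ᵢ`. -/
def christoffel
    (D : (∀ p : M, TangentSpace (𝓡 n) p) → (∀ p : M, TangentSpace (𝓡 n) p) →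
      ∀ v : TangentBundle (𝓡 n) M, TangentSpace (𝓡 n) v.proj)
    (e : Chart n M) (v : TangentBundle (𝓡 n) M) (i j k : Fin n) : ℝ :=
  comp e (D (globalCoordVec e v.proj j) (globalCoordVec e v.proj k)) i v

/-- The coefficients `Nⁱⱼ = Γⁱ_{jk} yᵏ` of the underlying nonlinear connection. -/
def underlyingCoeff (e : Chart n M) (Γ : TangentBundle (𝓡 n) M → Fin n → Fin n → Fin n → ℝ)
    (v : TangentBundle (𝓡 n) M) (i j : Fin n) : ℝ :=
  ∑ k, Γ v i j k * fib e v k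

/-- The endomorphism `∇Z : u ↦ ∇_u Z` of `T_{π(v)}M`, that is
`∇ⱼ Zⁱ = δⱼZⁱ + Γⁱ_{jk} Zᵏ`, for the anisotropic connection with symbols `Γ` in the chart `e`
and `δ` its underlying nonlinear connection. -/
def covVec (e : Chart n M) (Γ : TangentBundle (𝓡 n) M → Fin n → Fin n → Fin n → ℝ)
    (Z : ∀ v : TangentBundle (𝓡 n) M, TangentSpace (𝓡 n) v.proj)
    (v : TangentBundle (𝓡 n) M) :
    TangentSpace (𝓡 n) v.proj →ₗ[ℝ] TangentSpace (𝓡 n) v.proj :=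
  ∑ i, ∑ j, (delta e (underlyingCoeff e Γ) j (comp e Z i) v + ∑ k, Γ v i j k * comp e Z k v) •
    ((LinearMap.proj j).comp (components e v.proj)).smulRight (coordVec e i v.proj)

/-- The covariant derivative `∇_Z η` of an anisotropic `s`-form, evaluated at `v` on tangent vectors
`w₁, …, w_s`: `Z^H(η(W₁, …, W_s)) - ∑ η(W₁, …, ∇_Z W_ν, …, W_s)`,
where `W_ν` extends `w_ν` with constant components in the chart `e`. -/
def covForm (e : Chart n M) (Γ : TangentBundle (𝓡 n) M → Fin n → Fin n → Fin n → ℝ)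
    (Z : ∀ v : TangentBundle (𝓡 n) M, TangentSpace (𝓡 n) v.proj) {s : ℕ}
    (η : ∀ v : TangentBundle (𝓡 n) M, TangentSpace (𝓡 n) v.proj [⋀^Fin s]→ₗ[ℝ] ℝ)
    (v : TangentBundle (𝓡 n) M) (w : Fin s → TangentSpace (𝓡 n) v.proj) : ℝ :=
  ∑ k, comp e Z k v *
      delta e (underlyingCoeff e Γ) k (fun v' => η v' (fun ν => extend e v (w ν) v')) v
    - ∑ ν, η v (Function.update w ν (covVec e Γ (extend e v (w ν)) v (Z v)))

/-- The nonlinear connection underlying `D` is the metric one. -/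
def HasMetricConnection (A : Set (TangentBundle (𝓡 n) M)) (L : TangentBundle (𝓡 n) M → ℝ)
    (D : (∀ p : M, TangentSpace (𝓡 n) p) → (∀ p : M, TangentSpace (𝓡 n) p) →
      ∀ v : TangentBundle (𝓡 n) M, TangentSpace (𝓡 n) v.proj) : Prop :=
  ∀ e ∈ IsManifold.maximalAtlas (𝓡 n) ∞ M, ∀ v ∈ A, v.proj ∈ e.source →
    ∀ i j, underlyingCoeff e (christoffel D e) v i j = metricCoeff L e v i j

/-- `∇_Z η = 0` on `A`. -/
def IsParallelAlong (A : Set (TangentBundle (𝓡 n) M))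
    (D : (∀ p : M, TangentSpace (𝓡 n) p) → (∀ p : M, TangentSpace (𝓡 n) p) →
      ∀ v : TangentBundle (𝓡 n) M, TangentSpace (𝓡 n) v.proj)
    (Z : ∀ v : TangentBundle (𝓡 n) M, TangentSpace (𝓡 n) v.proj) {s : ℕ}
    (η : ∀ v : TangentBundle (𝓡 n) M, TangentSpace (𝓡 n) v.proj [⋀^Fin s]→ₗ[ℝ] ℝ) : Prop :=
  ∀ e ∈ IsManifold.maximalAtlas (𝓡 n) ∞ M, ∀ v ∈ A, v.proj ∈ e.source →
    ∀ w, covForm e (christoffel D e) Z η v w = 0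

/-- The (Levi-Civita–)Chern anisotropic connection of `L`: `∇_X Y = Xʲ (∂ⱼYⁱ + Γⁱ_{jk} Yᵏ) ∂ᵢ`
for isotropic `X`, `Y`, with the Chern symbols, computed at `v` in the preferred chart around
`π(v)`. -/
def chern (L : TangentBundle (𝓡 n) M → ℝ) (X Y : ∀ p : M, TangentSpace (𝓡 n) p)
    (v : TangentBundle (𝓡 n) M) : TangentSpace (𝓡 n) v.proj :=
  let e : Chart n M := chartAt (EuclideanSpace ℝ (Fin n)) v.proj
  covVec e (chernSymbol L e) (fun v' => Y v'.proj) v (X v.proj)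

end Basic

end AnisotropicFinsler

end

/-! Work in a chart and extend tangent vectors with constant components. An endomorphism acts on a
top-degree form, as a derivation, by its trace (`sum_det_updateRow`), so both derivatives of `dVol`
along `Z` are multiples of `dVol`. Let ℓ(Z) = ½ Zᵏ gⁱʲ δₖgᵢⱼ be the logarithmic horizontal
derivative of the density (`logVolumeDeriv`, by Jacobi's formula). Since 𝔩_Z ∂ⱼ = -δⱼZⁱ ∂ᵢ, the
factor of the Lie derivative is ℓ(Z) + δᵢZⁱ (`lieForm_volumeForm`). Since ∇_Z ∂ⱼ = Γⁱₖⱼ Zᵏ ∂ᵢ, the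
factor of the covariant derivative is ℓ(Z) - Γⁱₖᵢ Zᵏ (`covForm_volumeForm`). If the second factor
vanishes, the first is δᵢZⁱ + Γⁱₖᵢ Zᵏ, and symmetry of Γ makes this the trace of ∇Z.

For the Chern symbols, Γⁱₖᵢ = ½ gⁱʲ δₖgᵢⱼ because the other two terms cancel under contraction
(`sum_chernSymbol`), and Γⁱⱼₖ yᵏ = Nⁱⱼ because the Cartan tensor vanishes on y (`IsChern.apply_y`).

What remains is independence of the chart, since `divergence` and `chern` are both computed in a
preferred chart at each point. The covariant derivative built from the Chern symbols is chart-free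
(`covVec_chernSymbol_eq`), and `divergence_eq_trace` carries this over to the divergence. It rests
on the transformation laws of N and Γ, which are proved without indices: a `MetricJet` holds the
metric and its first derivative at one point, and γ, N, Γ are characterized by identities with a
lowered index, so that nondegeneracy reduces each law to a comparison of scalars. A negatively
oriented chart changes `dVol` only by a locally constant sign, which ℓ does not see. -/

noncomputable section

namespace AnisotropicFinsler

/-! ### Charts of `M`, the induced coordinates on `TM`, and their transition maps. -/

section Coordinates

set_option linter.unusedSectionVars false

variable {n : ℕ} {M : Type*} [TopologicalSpace M] [ChartedSpace (EuclideanSpace ℝ (Fin n)) M]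
  [IsManifold (𝓡 n) ∞ M]

local notation "𝔼" => EuclideanSpace ℝ (Fin n)

variable {e e' : Chart n M}

theorem dchart_constField (he : e ∈ IsManifold.maximalAtlas (𝓡 n) ∞ M) {p : M}
    (hp : p ∈ e.source) (c : 𝔼) : dchart e p (constField e c p) = c := by
  obtain ⟨f, hf⟩ := isInvertible_dchart he hp
  simp only [constField, ← hf, ContinuousLinearMap.inverse_equiv]
  exact f.apply_symm_apply c

theorem constField_dchart (he : e ∈ IsManifold.maximalAtlas (𝓡 n) ∞ M) {p : M}
    (hp : p ∈ e.source) (u : TangentSpace (𝓡 n) p) : constField e (dchart e p u) p = u := by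
  obtain ⟨f, hf⟩ := isInvertible_dchart he hp
  simp only [constField, ← hf, ContinuousLinearMap.inverse_equiv]
  exact f.symm_apply_apply u

theorem dchart_injective (he : e ∈ IsManifold.maximalAtlas (𝓡 n) ∞ M) {p : M}
    (hp : p ∈ e.source) {u w : TangentSpace (𝓡 n) p} (h : dchart e p u = dchart e p w) : u = w := by
  rw [← constField_dchart he hp u, h, constField_dchart he hp w]

theorem param_coord (he : e ∈ IsManifold.maximalAtlas (𝓡 n) ∞ M) {v : TangentBundle (𝓡 n) M}
    (hv : v.proj ∈ e.source) : param e (coord e v) = v := by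
  obtain ⟨p, u⟩ := v
  have h : e.symm (e p) = p := e.left_inv hv
  simp only [param, coord]
  rw [h, constField_dchart he hv]

theorem coord_param (he : e ∈ IsManifold.maximalAtlas (𝓡 n) ∞ M) {z : 𝔼 × 𝔼}
    (hz : z.1 ∈ e.target) : coord e (param e z) = z := by
  ext1
  · exact e.right_inv hz
  · exact dchart_constField he (e.map_target hz) _

/-- Replaces a pointwise inverse of linear maps by a derivative of `e.symm`, for which smoothness
and the chain rule are at hand. -/
theorem inverse_dchart (he : e ∈ IsManifold.maximalAtlas (𝓡 n) ∞ M) {x : 𝔼}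
    (hx : x ∈ e.target) : (dchart e (e.symm x)).inverse = mfderiv (𝓡 n) (𝓡 n) e.symm x := by
  have he1 : e ∈ IsManifold.maximalAtlas (𝓡 n) 1 M :=
    IsManifold.maximalAtlas_subset_of_le (by norm_cast) he
  have hd : e.MDifferentiable (𝓡 n) (𝓡 n) :=
    ⟨fun x hx => (mdifferentiableAt_of_mem_maximalAtlas he1 hx).mdifferentiableWithinAt,
      fun x hx => (mdifferentiableAt_symm_of_mem_maximalAtlas he1 hx).mdifferentiableWithinAt⟩
  have hp := e.map_target hx
  refine (ContinuousLinearMap.inverse_equiv (hd.mfderiv hp)).trans ?_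
  change mfderiv (𝓡 n) (𝓡 n) e.symm (e (e.symm x)) = _
  rw [e.right_inv hx]

theorem contMDiff_mk_tangentBundle_model : ContMDiff 𝓘(ℝ, 𝔼 × 𝔼) (𝓡 n).tangent ∞
    (fun z : 𝔼 × 𝔼 => (⟨z.1, z.2⟩ : TangentBundle (𝓡 n) 𝔼)) := by
  intro z
  rw [Bundle.contMDiffAt_totalSpace]
  refine ⟨contMDiffAt_iff_contDiffAt.2 contDiffAt_fst, ?_⟩
  simp only [trivializationAt_model_space_apply]
  exact contMDiffAt_iff_contDiffAt.2 contDiffAt_snd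

/-- `param e` is the tangent map of `e.symm`, after identifying pairs `(x, y)` with tangent vectors
of the model space. -/
theorem contMDiffOn_param (he : e ∈ IsManifold.maximalAtlas (𝓡 n) ∞ M) :
    ContMDiffOn 𝓘(ℝ, 𝔼 × 𝔼) (𝓡 n).tangent ∞ (param e) (e.target ×ˢ Set.univ) := by
  have h1 : ContMDiffOn (𝓡 n) (𝓡 n) ∞ e.symm e.target := contMDiffOn_symm_of_mem_maximalAtlas he
  have h2 := h1.contMDiffOn_tangentMapWithin (m := ∞) (by norm_cast) e.open_target.uniqueMDiffOn
  have h4 := h2.comp (contMDiff_mk_tangentBundle_model.contMDiffOn (s := e.target ×ˢ Set.univ))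
    (fun z hz => hz.1)
  refine h4.congr fun z hz => ?_
  have hz1 : z.1 ∈ e.target := hz.1
  simp only [Function.comp]
  change _ = (⟨e.symm z.1, mfderivWithin (𝓡 n) (𝓡 n) e.symm e.target z.1 z.2⟩ :
    TangentBundle (𝓡 n) M)
  rw [mfderivWithin_of_isOpen e.open_target hz1, ← inverse_dchart he hz1]
  rfl

theorem contMDiffAt_param (he : e ∈ IsManifold.maximalAtlas (𝓡 n) ∞ M) {z : 𝔼 × 𝔼}
    (hz : z.1 ∈ e.target) : ContMDiffAt 𝓘(ℝ, 𝔼 × 𝔼) (𝓡 n).tangent ∞ (param e) z :=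
  (contMDiffOn_param he).contMDiffAt
    ((e.open_target.prod isOpen_univ).mem_nhds ⟨hz, Set.mem_univ _⟩)

theorem contMDiffAt_coord (he : e ∈ IsManifold.maximalAtlas (𝓡 n) ∞ M)
    {v : TangentBundle (𝓡 n) M} (hv : v.proj ∈ e.source) :
    ContMDiffAt (𝓡 n).tangent 𝓘(ℝ, 𝔼 × 𝔼) ∞ (coord e) v := by
  have h1 : ContMDiffOn (𝓡 n) (𝓡 n) ∞ e e.source := contMDiffOn_of_mem_maximalAtlas he
  have h2 := h1.contMDiffOn_tangentMapWithin (m := ∞) (by norm_cast) e.open_source.uniqueMDiffOn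
  have h3 := contMDiff_tangentBundleModelSpaceHomeomorph (I := 𝓡 n) (n := ∞)
  have h4 := h3.comp_contMDiffOn h2
  rw [modelWithCornersSelf_prod]
  have ho : IsOpen ((Bundle.TotalSpace.proj : TangentBundle (𝓡 n) M → M) ⁻¹' e.source) :=
    e.open_source.preimage (FiberBundle.continuous_proj _ _)
  refine (h4.congr fun w hw => ?_).contMDiffAt (ho.mem_nhds hv)
  have hw1 : w.proj ∈ e.source := hw
  simp only [Function.comp]
  change _ = (e w.proj, mfderivWithin (𝓡 n) (𝓡 n) e e.source w.proj w.2)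
  rw [mfderivWithin_of_isOpen e.open_source hw1]
  rfl

theorem tendsto_param (he : e ∈ IsManifold.maximalAtlas (𝓡 n) ∞ M)
    {v : TangentBundle (𝓡 n) M} (hv : v.proj ∈ e.source) :
    Filter.Tendsto (param e) (𝓝 (coord e v)) (𝓝 v) := by
  have := (contMDiffAt_param he (z := coord e v) (e.map_source hv)).continuousAt
  rwa [ContinuousAt, param_coord he hv] at this

theorem eventually_fst_mem_target {v : TangentBundle (𝓡 n) M} (hv : v.proj ∈ e.source) :
    ∀ᶠ z in 𝓝 (coord e v), z.1 ∈ e.target :=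
  continuous_fst.continuousAt.eventually (e.open_target.mem_nhds (e.map_source hv))

theorem eventually_proj_mem {v : TangentBundle (𝓡 n) M} (hv : v.proj ∈ e.source) :
    ∀ᶠ w in 𝓝 v, w.proj ∈ e.source :=
  (FiberBundle.continuous_proj 𝔼 (TangentSpace (𝓡 n))).continuousAt.eventually
    (e.open_source.mem_nhds hv)

/-- The coordinate change from `e` to `e'` on `M`. -/
def transition (e e' : Chart n M) (x : 𝔼) : 𝔼 := e' (e.symm x)

/-- The Jacobian of the coordinate change from `e` to `e'` at `p`. -/
def jacobian (e e' : Chart n M) (p : M) : 𝔼 →L[ℝ] 𝔼 := (dchart e' p).comp (dchart e p).inverse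

theorem jacobian_dchart (he : e ∈ IsManifold.maximalAtlas (𝓡 n) ∞ M) {p : M} (hp : p ∈ e.source)
    (u : TangentSpace (𝓡 n) p) : jacobian e e' p (dchart e p u) = dchart e' p u := by
  change dchart e' p (constField e (dchart e p u) p) = _
  rw [constField_dchart he hp]

theorem constField_jacobian (he' : e' ∈ IsManifold.maximalAtlas (𝓡 n) ∞ M) {p : M}
    (hp' : p ∈ e'.source) (c : 𝔼) : constField e' (jacobian e e' p c) p = constField e c p :=
  constField_dchart he' hp' _

theorem jacobian_comp (he : e ∈ IsManifold.maximalAtlas (𝓡 n) ∞ M)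
    (he' : e' ∈ IsManifold.maximalAtlas (𝓡 n) ∞ M) {p : M} (hp : p ∈ e.source)
    (hp' : p ∈ e'.source) (c : 𝔼) : jacobian e' e p (jacobian e e' p c) = c := by
  change dchart e p (constField e' (jacobian e e' p c) p) = c
  rw [constField_jacobian he' hp', dchart_constField he hp]

theorem contDiffAt_transition (he : e ∈ IsManifold.maximalAtlas (𝓡 n) ∞ M)
    (he' : e' ∈ IsManifold.maximalAtlas (𝓡 n) ∞ M) {x : 𝔼} (hx : x ∈ e.target)
    (hx' : e.symm x ∈ e'.source) : ContDiffAt ℝ ∞ (transition e e') x :=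
  contMDiffAt_iff_contDiffAt.1
    ((contMDiffAt_of_mem_maximalAtlas he' hx').comp x (contMDiffAt_symm_of_mem_maximalAtlas he hx))

theorem fderiv_transition (he : e ∈ IsManifold.maximalAtlas (𝓡 n) ∞ M)
    (he' : e' ∈ IsManifold.maximalAtlas (𝓡 n) ∞ M) {x : 𝔼} (hx : x ∈ e.target)
    (hx' : e.symm x ∈ e'.source) :
    fderiv ℝ (transition e e') x = jacobian e e' (e.symm x) := by
  have h1 := (contMDiffAt_of_mem_maximalAtlas he' hx').mdifferentiableAt (by norm_cast : (∞ : ℕ∞ω) ≠ 0)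
  have h2 := (contMDiffAt_symm_of_mem_maximalAtlas he hx).mdifferentiableAt
    (by norm_cast : (∞ : ℕ∞ω) ≠ 0)
  have h3 := mfderiv_comp x h1 h2
  rw [jacobian, inverse_dchart he hx, ← mfderiv_eq_fderiv]
  exact h3

theorem eventually_mem_overlap {p : M} (hp : p ∈ e.source) (hp' : p ∈ e'.source) :
    ∀ᶠ x in 𝓝 (e p), x ∈ e.target ∧ e.symm x ∈ e'.source := by
  refine Filter.Eventually.and (e.open_target.mem_nhds (e.map_source hp)) ?_
  have := e.continuousAt_symm (e.map_source hp)
  rw [ContinuousAt, e.left_inv hp] at this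
  exact this.eventually (e'.open_source.mem_nhds hp')

/-- The coordinate change from `e` to `e'` on `TM`. -/
def transitionTM (e e' : Chart n M) (z : 𝔼 × 𝔼) : 𝔼 × 𝔼 :=
  (transition e e' z.1, fderiv ℝ (transition e e') z.1 z.2)

theorem transitionTM_eq (he : e ∈ IsManifold.maximalAtlas (𝓡 n) ∞ M)
    (he' : e' ∈ IsManifold.maximalAtlas (𝓡 n) ∞ M) {z : 𝔼 × 𝔼} (hx : z.1 ∈ e.target)
    (hx' : e.symm z.1 ∈ e'.source) : transitionTM e e' z = coord e' (param e z) := by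
  rw [transitionTM, fderiv_transition he he' hx hx']
  rfl

theorem param_transitionTM (he : e ∈ IsManifold.maximalAtlas (𝓡 n) ∞ M)
    (he' : e' ∈ IsManifold.maximalAtlas (𝓡 n) ∞ M) {z : 𝔼 × 𝔼} (hx : z.1 ∈ e.target)
    (hx' : e.symm z.1 ∈ e'.source) : param e' (transitionTM e e' z) = param e z := by
  rw [transitionTM_eq he he' hx hx', param_coord he' hx']

theorem transitionTM_coord (he : e ∈ IsManifold.maximalAtlas (𝓡 n) ∞ M)
    (he' : e' ∈ IsManifold.maximalAtlas (𝓡 n) ∞ M) {v : TangentBundle (𝓡 n) M}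
    (hv : v.proj ∈ e.source) (hv' : v.proj ∈ e'.source) :
    transitionTM e e' (coord e v) = coord e' v := by
  rw [transitionTM_eq he he' (e.map_source hv) (by rw [coord, e.left_inv hv]; exact hv'),
    param_coord he hv]

/-- The fibre coordinate transforms as J(x)y, so a displacement h of x also moves it by the second
derivative applied to (h, y). All inhomogeneous terms in the transformation laws come from here and
from differentiating J. -/
theorem hasFDerivAt_transitionTM (he : e ∈ IsManifold.maximalAtlas (𝓡 n) ∞ M)
    (he' : e' ∈ IsManifold.maximalAtlas (𝓡 n) ∞ M) {z : 𝔼 × 𝔼} (hx : z.1 ∈ e.target)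
    (hx' : e.symm z.1 ∈ e'.source) :
    ∃ T : 𝔼 × 𝔼 →L[ℝ] 𝔼 × 𝔼, HasFDerivAt (transitionTM e e') T z ∧ ∀ h w,
      T (h, w) = (fderiv ℝ (transition e e') z.1 h,
        fderiv ℝ (fderiv ℝ (transition e e')) z.1 h z.2 + fderiv ℝ (transition e e') z.1 w) := by
  have hc := contDiffAt_transition he he' hx hx'
  have h1 : HasFDerivAt (transition e e') (fderiv ℝ (transition e e') z.1) z.1 :=
    (hc.differentiableAt (by norm_cast)).hasFDerivAt
  have h2 : HasFDerivAt (fderiv ℝ (transition e e')) (fderiv ℝ (fderiv ℝ (transition e e')) z.1)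
      z.1 := ((hc.fderiv_right (m := 1) (by norm_cast)).differentiableAt (by norm_cast)).hasFDerivAt
  have h3 := (h1.comp z hasFDerivAt_fst).prodMk ((h2.comp z hasFDerivAt_fst).clm_apply hasFDerivAt_snd)
  exact ⟨_, h3, fun h w => by simp [add_comm]⟩

/-! ### Smoothness in coordinates -/

theorem IsAnisoFunction.contDiffAt {A : Set (TangentBundle (𝓡 n) M)} (hA : IsOpen A)
    (he : e ∈ IsManifold.maximalAtlas (𝓡 n) ∞ M) {f : TangentBundle (𝓡 n) M → ℝ}
    (hf : IsAnisoFunction A f) {v : TangentBundle (𝓡 n) M} (hv : v ∈ A) (hve : v.proj ∈ e.source) :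
    ContDiffAt ℝ ∞ (fun z => f (param e z)) (coord e v) := by
  have h1 := hf.contMDiffAt (hA.mem_nhds hv)
  rw [← param_coord he hve] at h1
  exact contMDiffAt_iff_contDiffAt.1
    (h1.comp (coord e v) (contMDiffAt_param he (e.map_source hve)))

theorem contMDiffAt_of_contDiffAt_param (he : e ∈ IsManifold.maximalAtlas (𝓡 n) ∞ M)
    {f : TangentBundle (𝓡 n) M → ℝ} {v : TangentBundle (𝓡 n) M} (hve : v.proj ∈ e.source)
    (hf : ContDiffAt ℝ ∞ (fun z => f (param e z)) (coord e v)) :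
    ContMDiffAt (𝓡 n).tangent 𝓘(ℝ, ℝ) ∞ f v := by
  refine ((contMDiffAt_iff_contDiffAt.2 hf).comp v (contMDiffAt_coord he hve)).congr_of_eventuallyEq ?_
  filter_upwards [eventually_proj_mem hve] with w hw
  simp [param_coord he hw]

/-- The components in the chart `e` of an anisotropic vector field, as a function of the natural
coordinates. -/
def localRep (e : Chart n M) (Z : ∀ v : TangentBundle (𝓡 n) M, TangentSpace (𝓡 n) v.proj)
    (z : 𝔼 × 𝔼) : 𝔼 :=
  dchart e (e.symm z.1) (Z (param e z))

theorem localRep_coord (he : e ∈ IsManifold.maximalAtlas (𝓡 n) ∞ M)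
    (Z : ∀ v : TangentBundle (𝓡 n) M, TangentSpace (𝓡 n) v.proj) {v : TangentBundle (𝓡 n) M}
    (hv : v.proj ∈ e.source) : localRep e Z (coord e v) = dchart e v.proj (Z v) := by
  -- The two sides live in tangent spaces at points that are only propositionally equal;
  -- generalizing to a variable `w` lets the equality be substituted. The same device recurs below.
  have : ∀ w : TangentBundle (𝓡 n) M, w = v → dchart e w.proj (Z w) = dchart e v.proj (Z v) := by
    rintro w rfl; rfl
  exact this _ (param_coord he hv)

theorem localRep_transitionTM (he : e ∈ IsManifold.maximalAtlas (𝓡 n) ∞ M)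
    (he' : e' ∈ IsManifold.maximalAtlas (𝓡 n) ∞ M)
    (Z : ∀ v : TangentBundle (𝓡 n) M, TangentSpace (𝓡 n) v.proj) {z : 𝔼 × 𝔼} (hx : z.1 ∈ e.target)
    (hx' : e.symm z.1 ∈ e'.source) :
    localRep e' Z (transitionTM e e' z) = fderiv ℝ (transition e e') z.1 (localRep e Z z) := by
  rw [transitionTM_eq he he' hx hx', localRep_coord he' Z (v := param e z) hx',
    fderiv_transition he he' hx hx', localRep]
  exact (jacobian_dchart he (e.map_target hx) _).symm

theorem IsAnisoVectorField.contDiffAt {A : Set (TangentBundle (𝓡 n) M)} (hA : IsOpen A)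
    (he : e ∈ IsManifold.maximalAtlas (𝓡 n) ∞ M)
    {Z : ∀ v : TangentBundle (𝓡 n) M, TangentSpace (𝓡 n) v.proj} (hZ : IsAnisoVectorField A Z)
    {v : TangentBundle (𝓡 n) M} (hv : v ∈ A) (hve : v.proj ∈ e.source) :
    ContDiffAt ℝ ∞ (localRep e Z) (coord e v) := by
  have h1 := hZ.contMDiffAt (hA.mem_nhds hv)
  have h2 := (contMDiffAt_coord he (v := ⟨v.proj, Z v⟩) hve).comp v h1
  rw [← param_coord he hve] at h2
  exact (contMDiffAt_iff_contDiffAt.1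
    (h2.comp (coord e v) (contMDiffAt_param he (e.map_source hve)))).snd

/-- Near v the section is `param e` applied to the base coordinates and the local components, hence
smooth when these are. The chart may depend on the point. -/
theorem isAnisoVectorField_of_localRep {A : Set (TangentBundle (𝓡 n) M)}
    {Z : ∀ v : TangentBundle (𝓡 n) M, TangentSpace (𝓡 n) v.proj}
    (h : ∀ v ∈ A, ∃ e ∈ IsManifold.maximalAtlas (𝓡 n) ∞ M, v.proj ∈ e.source ∧
      ContDiffAt ℝ ∞ (localRep e Z) (coord e v)) : IsAnisoVectorField A Z := by
  intro v hv
  obtain ⟨e, he, hve, hc⟩ := h v hv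
  refine ContMDiffAt.contMDiffWithinAt ?_
  have h1 : ContDiffAt ℝ ∞ (fun z : 𝔼 × 𝔼 => (z.1, localRep e Z z)) (coord e v) :=
    contDiffAt_fst.prodMk hc
  have h2 := (contMDiffAt_iff_contDiffAt.2 h1).comp v (contMDiffAt_coord he hve)
  have h3 := (contMDiffAt_param he (z := ((coord e v).1, localRep e Z (coord e v)))
    (e.map_source hve)).comp v h2
  refine h3.congr_of_eventuallyEq ?_
  filter_upwards [eventually_proj_mem hve] with w hw
  have h4 := param_coord he (v := ⟨w.proj, Z w⟩) hw
  simp only [Function.comp, localRep_coord he Z hw]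
  exact h4.symm

theorem IsVectorField.isAnisoVectorField {X : ∀ p : M, TangentSpace (𝓡 n) p}
    (hX : IsVectorField X) (A : Set (TangentBundle (𝓡 n) M)) :
    IsAnisoVectorField A (fun v => X v.proj) :=
  (ContMDiff.comp hX (Bundle.contMDiff_proj (TangentSpace (𝓡 n)))).contMDiffOn

/-! ### Coordinate derivatives -/

/-- δₖ is the derivative along the single horizontal vector (eₖ, -N eₖ), which makes the chain rule
applicable to it. -/
theorem delta_eq (N : TangentBundle (𝓡 n) M → Fin n → Fin n → ℝ) (k : Fin n)
    (f : TangentBundle (𝓡 n) M → ℝ) (v : TangentBundle (𝓡 n) M) :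
    delta e N k f v = fderiv ℝ (fun z => f (param e z)) (coord e v)
      (EuclideanSpace.single k 1, -WithLp.toLp 2 (fun j => N v j k)) := by
  have h1 : (WithLp.toLp 2 (fun j => N v j k) : 𝔼)
      = ∑ j, N v j k • EuclideanSpace.single j (1 : ℝ) := by
    ext i; simp [Finset.sum_apply, Pi.single_apply]
  have h2 : ((EuclideanSpace.single k 1, -WithLp.toLp 2 (fun j => N v j k)) : 𝔼 × 𝔼)
      = (EuclideanSpace.single k 1, 0)
        - ∑ j, N v j k • ((0, EuclideanSpace.single j (1 : ℝ)) : 𝔼 × 𝔼) := by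
    ext1
    · simp [Prod.fst_sum]
    · simp [Prod.snd_sum, h1]
  rw [h2, map_sub, map_sum]
  simp only [map_smul, smul_eq_mul]
  rfl

end Coordinates

/-! ### Pointwise linear algebra: formal Christoffel symbols, metric connection, Chern symbols and
their transformation laws. -/

section MetricJet

variable {E : Type*} [NormedAddCommGroup E] [NormedSpace ℝ E]

/-- The value `G` and the differential `D` of a field of bilinear forms at a point `(x, y)` of
`E × E`, with the symmetries which they have for the fundamental tensor of a pseudo-Finsler
metric. -/
structure MetricJet (E : Type*) [NormedAddCommGroup E] [NormedSpace ℝ E] where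
  /-- The supporting element. -/
  y : E
  /-- The fundamental tensor. -/
  G : E →L[ℝ] E →L[ℝ] ℝ
  /-- The differential of the fundamental tensor. -/
  D : E × E →L[ℝ] E →L[ℝ] E →L[ℝ] ℝ
  nondegenerate : ∀ u, (∀ w, G u w = 0) → u = 0
  symm : ∀ u w, G u w = G w u
  D_symm : ∀ h u w, D h u w = D h w u
  cartan_symm : ∀ a b c, D (0, a) b c = D (0, b) a c
  cartan_y : ∀ b c, D (0, y) b c = 0

namespace MetricJet

variable (m : MetricJet E)

/-- `γ` is given by the formal Christoffel symbols. -/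
def IsFormalChristoffel (γ : E → E → E) : Prop :=
  ∀ j k l, m.G (γ j k) l = 1 / 2 * (m.D (k, 0) l j + m.D (j, 0) l k - m.D (l, 0) j k)

/-- `N` is the metric nonlinear connection. -/
def IsMetricConnection (γ : E → E → E) (N : E → E) : Prop :=
  ∀ j l, m.G (N j) l = m.G (γ j m.y) l - 1 / 2 * m.D (0, γ m.y m.y) l j

/-- `Γ` is given by the Chern symbols. -/
def IsChern (N : E → E) (Γ : E → E → E) : Prop :=
  ∀ j k l, m.G (Γ j k) l =
    1 / 2 * (m.D (k, -N k) l j + m.D (j, -N j) l k - m.D (l, -N l) j k)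

variable {m}

/-- Nondegeneracy in the form used throughout: a vector is determined by its lowered index, so
inverse matrices never enter the arguments. -/
theorem eq_of_forall {u u' : E} (h : ∀ w, m.G u w = m.G u' w) : u = u' :=
  sub_eq_zero.1 (m.nondegenerate _ fun w => by simp [h w])

theorem D_mk (h w b c : E) : m.D (h, w) b c = m.D (h, 0) b c + m.D (0, w) b c := by
  have : ((h, w) : E × E) = (h, 0) + (0, w) := by simp
  rw [this, map_add]; rfl

theorem D_mk_neg (h w b c : E) : m.D (h, -w) b c = m.D (h, 0) b c - m.D (0, w) b c := by
  have : ((h, -w) : E × E) = (h, 0) - (0, w) := by simp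
  rw [this, map_sub]; rfl

/-- Symmetry of the Cartan tensor moves y into the differentiation slot, where homogeneity kills it.
-/
theorem D_zero_right (a c : E) : m.D (0, a) m.y c = 0 := by
  rw [m.cartan_symm, m.cartan_y]

theorem D_zero_right' (a c : E) : m.D (0, a) c m.y = 0 := by
  rw [m.D_symm, D_zero_right]

theorem D_zero_add (a b u w : E) : m.D (0, a + b) u w = m.D (0, a) u w + m.D (0, b) u w := by
  have : ((0, a + b) : E × E) = (0, a) + (0, b) := by simp
  rw [this, map_add]; rfl

variable {γ Γ : E → E → E} {N : E → E}

/-- At j = y the Cartan correction has y among its arguments and drops out, leaving the spray γ(y,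
y). -/
theorem IsMetricConnection.apply_y (hN : m.IsMetricConnection γ N) : N m.y = γ m.y m.y :=
  eq_of_forall fun w => by rw [hN, D_zero_right']; ring

/-- Exchanging j and k swaps the first two Koszul terms and fixes the third. -/
theorem IsChern.symm (hΓ : m.IsChern N Γ) (j k : E) : Γ j k = Γ k j :=
  eq_of_forall fun w => by rw [hΓ, hΓ, m.D_symm _ j k]; ring

/-- The nonlinear connection underlying the Chern connection is the metric one. -/
theorem IsChern.apply_y (hγ : m.IsFormalChristoffel γ) (hN : m.IsMetricConnection γ N)
    (hΓ : m.IsChern N Γ) (j : E) : Γ j m.y = N j := by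
  refine eq_of_forall (m := m) fun l => ?_
  -- Of the three vertical corrections, two have y as an argument and vanish; the third is
  -- differentiation along N y = γ(y, y), which is precisely the Cartan term of N.
  rw [hΓ, hN, hγ, D_mk_neg, D_mk_neg, D_mk_neg, hN.apply_y, D_zero_right', D_zero_right']
  ring

/-- `J` and `B` are the first and second differentials of a change of coordinates which maps the
metric `m` to `m'`. -/
structure Transforms (m m' : MetricJet E) (J : E →L[ℝ] E) (B : E →L[ℝ] E →L[ℝ] E) : Prop where
  surj : Function.Surjective J
  symm : ∀ h k, B h k = B k h
  y_eq : m'.y = J m.y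
  G_eq : ∀ c d, m.G c d = m'.G (J c) (J d)
  D_eq : ∀ h w c d, m.D (h, w) c d =
    m'.D (J h, B h m.y + J w) (J c) (J d) + m'.G (B h c) (J d) + m'.G (J c) (B h d)

variable {m' : MetricJet E} {J : E →L[ℝ] E} {B : E →L[ℝ] E →L[ℝ] E}
  {γ' Γ' : E → E → E} {N' : E → E}

/-- Surjectivity of J allows testing only on vectors J l, where the metrics can be compared. -/
theorem Transforms.eq_of_forall (T : Transforms m m' J B) {u u' : E}
    (h : ∀ l, m'.G u (J l) = m'.G u' (J l)) : u = u' :=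
  MetricJet.eq_of_forall fun w => by obtain ⟨l, rfl⟩ := T.surj w; exact h l

theorem Transforms.D_left (T : Transforms m m' J B) (h c d : E) : m.D (h, 0) c d =
    m'.D (J h, 0) (J c) (J d) + m'.D (0, B h m.y) (J c) (J d) + m'.G (B h c) (J d)
      + m'.G (J c) (B h d) := by
  rw [T.D_eq, map_zero, add_zero, D_mk]

/-- No second derivative appears: the Cartan tensor is a genuine tensor. -/
theorem Transforms.D_right (T : Transforms m m' J B) (w c d : E) : m.D (0, w) c d =
    m'.D (0, J w) (J c) (J d) := by
  rw [T.D_eq]; simp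

/-- The spray law is needed first, because the spray occurs inside the Cartan term of N. Its
inhomogeneous part B(y, y) then cancels the vertical derivative along B(y, y) coming from the formal
Christoffel symbols, and only B(j, y) is left. -/
theorem Transforms.metricConnection (T : Transforms m m' J B) (hγ : m.IsFormalChristoffel γ)
    (hN : m.IsMetricConnection γ N) (hγ' : m'.IsFormalChristoffel γ')
    (hN' : m'.IsMetricConnection γ' N') (j : E) : J (N j) = N' (J j) + B j m.y := by
  have hz : ∀ a c, m'.D (0, a) c (J m.y) = 0 := fun a c => by rw [← T.y_eq, D_zero_right']
  have hs : J (γ m.y m.y) = γ' m'.y m'.y + B m.y m.y := by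
    refine T.eq_of_forall fun l => ?_
    rw [← T.G_eq, hγ, map_add, _root_.add_apply, hγ', T.D_left, T.D_left, T.y_eq]
    simp only [hz, T.symm l, m'.symm (J l), m'.symm (J m.y)]
    ring
  refine T.eq_of_forall fun l => ?_
  rw [← T.G_eq, hN, hγ, map_add, _root_.add_apply, hN', hγ', T.D_left, T.D_left,
    T.D_left, T.D_right, hs, D_zero_add, T.y_eq]
  simp only [hz, T.symm l, T.symm m.y j, m'.symm (J l), m'.symm (J j)]
  ring

/-- By the law for N, the horizontal lift of h is mapped to the horizontal lift of J h. Horizontal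
derivatives of the metric therefore change only by the two terms from differentiating J, and the
Koszul combination of these is B(j, k), as for Levi-Civita. -/
theorem Transforms.chern (T : Transforms m m' J B) (hN : ∀ j, J (N j) = N' (J j) + B j m.y)
    (hΓ : m.IsChern N Γ) (hΓ' : m'.IsChern N' Γ') (j k : E) :
    J (Γ j k) = Γ' (J j) (J k) + B j k := by
  have hD : ∀ h c d, m.D (h, -N h) c d = m'.D (J h, -N' (J h)) (J c) (J d) + m'.G (B h c) (J d)
      + m'.G (J c) (B h d) := fun h c d => by
    rw [T.D_eq, map_neg, hN]
    simp
  refine T.eq_of_forall fun l => ?_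
  rw [← T.G_eq, hΓ, map_add, _root_.add_apply, hΓ', hD, hD, hD]
  simp only [T.symm l, T.symm k j, m'.symm (J l), m'.symm (J j)]
  ring

end MetricJet

end MetricJet

/-! ### The fundamental tensor as a second fibre derivative: symmetries and Euler's relation. -/

section FundamentalForm

set_option linter.unusedSectionVars false

variable {E : Type*} [NormedAddCommGroup E] [NormedSpace ℝ E]

/-- Half of the second differential of `ℓ` in the second variable. -/
def fundForm (ℓ : E × E → ℝ) (z : E × E) : E →L[ℝ] E →L[ℝ] ℝ :=
  (1 / 2 : ℝ) • ((ContinuousLinearMap.compL ℝ E (E × E) ℝ).flip (ContinuousLinearMap.inr ℝ E E)).comp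
    ((fderiv ℝ (fderiv ℝ ℓ) z).comp (ContinuousLinearMap.inr ℝ E E))

variable {ℓ : E × E → ℝ} {z : E × E}

theorem fundForm_apply (c d : E) :
    fundForm ℓ z c d = 1 / 2 * fderiv ℝ (fderiv ℝ ℓ) z (0, c) (0, d) := by
  simp [fundForm]

theorem deriv_deriv_eq_fundForm (h : ContDiffAt ℝ ∞ ℓ z) (c d : E) :
    1 / 2 * deriv (fun s : ℝ => deriv (fun t : ℝ => ℓ (z.1, z.2 + s • c + t • d)) 0) 0
      = fundForm ℓ z c d := by
  rw [fundForm_apply]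
  congr 1
  have hline : ∀ w a : E, ∀ t : ℝ,
      HasDerivAt (fun t : ℝ => ((z.1, w + t • a) : E × E)) (0, a) t := fun w a t => by
    have h2 : HasDerivAt (fun t : ℝ => w + t • a) a t := by
      simpa using ((hasDerivAt_id t).smul_const a).const_add w
    exact (hasDerivAt_const t z.1).prodMk h2
  have hcont : Filter.Tendsto (fun s : ℝ => ((z.1, z.2 + s • c) : E × E)) (𝓝 0) (𝓝 z) := by
    have := (hline z.2 c 0).continuousAt
    simpa [ContinuousAt] using this
  have h1 : ∀ᶠ s : ℝ in 𝓝 0, deriv (fun t : ℝ => ℓ (z.1, z.2 + s • c + t • d)) 0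
      = fderiv ℝ ℓ (z.1, z.2 + s • c) (0, d) := by
    -- Smoothness of order ∞ at a point provides neighbourhoods only order by order, so a finite
    -- order is fixed before passing to nearby points.
    have hd : ∀ᶠ z' in 𝓝 z, ContDiffAt ℝ 1 ℓ z' :=
      (h.of_le (m := 1) (by norm_cast)).eventually (by norm_cast)
    filter_upwards [hcont.eventually hd] with s hs
    have h3 : HasFDerivAt ℓ (fderiv ℝ ℓ (z.1, z.2 + s • c)) (z.1, z.2 + s • c + (0 : ℝ) • d) := by
      rw [zero_smul, add_zero]
      exact (hs.differentiableAt (by norm_cast)).hasFDerivAt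
    exact (h3.comp_hasDerivAt (0 : ℝ) (hline (z.2 + s • c) d 0)).deriv
  rw [Filter.EventuallyEq.deriv_eq h1]
  have h4 : HasFDerivAt (fderiv ℝ ℓ) (fderiv ℝ (fderiv ℝ ℓ) z) (z.1, z.2 + (0 : ℝ) • c) := by
    rw [zero_smul, add_zero]
    exact ((h.fderiv_right (m := 1) (by norm_cast)).differentiableAt (by norm_cast)).hasFDerivAt
  have h5 := h4.comp_hasDerivAt (0 : ℝ) (hline z.2 c 0)
  have h6 := (h5.clm_apply (hasDerivAt_const (0 : ℝ) ((0, d) : E × E))).deriv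
  simpa using h6

theorem contDiffAt_fundForm (h : ContDiffAt ℝ ∞ ℓ z) : ContDiffAt ℝ ∞ (fundForm ℓ) z := by
  have h2 : ContDiffAt ℝ ∞ (fderiv ℝ (fderiv ℝ ℓ)) z :=
    (h.fderiv_right (m := ∞) (by norm_cast)).fderiv_right (by norm_cast)
  exact (contDiffAt_const.clm_comp (h2.clm_comp contDiffAt_const)).const_smul _

theorem fundForm_symm (h : ContDiffAt ℝ ∞ ℓ z) (c d : E) : fundForm ℓ z c d = fundForm ℓ z d c := by
  rw [fundForm_apply, fundForm_apply]
  rw [(h.isSymmSndFDerivAt (by simp [minSmoothness_of_isRCLikeNormedField]; norm_cast)).eq]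

theorem fderiv_fundForm_apply (h : ContDiffAt ℝ ∞ ℓ z) (w : E × E) (c d : E) :
    fderiv ℝ (fundForm ℓ) z w c d
      = 1 / 2 * fderiv ℝ (fderiv ℝ (fderiv ℝ ℓ)) z w (0, c) (0, d) := by
  have h1 : HasFDerivAt (fundForm ℓ) (fderiv ℝ (fundForm ℓ) z) z :=
    ((contDiffAt_fundForm h).differentiableAt (by norm_cast)).hasFDerivAt
  have h2 : HasFDerivAt (fderiv ℝ (fderiv ℝ ℓ)) (fderiv ℝ (fderiv ℝ (fderiv ℝ ℓ)) z) z :=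
    (((h.fderiv_right (m := ∞) (by norm_cast)).fderiv_right (m := ∞)
      (by norm_cast)).differentiableAt (by norm_cast)).hasFDerivAt
  have h3 := (h1.clm_apply (hasFDerivAt_const c z)).clm_apply (hasFDerivAt_const d z)
  have h4 := ((h2.clm_apply (hasFDerivAt_const ((0, c) : E × E) z)).clm_apply
    (hasFDerivAt_const ((0, d) : E × E) z)).const_mul (1 / 2 : ℝ)
  have h5 : (fun x => fundForm ℓ x c d) = fun x => 1 / 2 * fderiv ℝ (fderiv ℝ ℓ) x (0, c) (0, d) :=
    funext fun x => fundForm_apply c d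
  rw [h5] at h3
  have := DFunLike.congr_fun (h3.unique h4) w
  simpa using this

/-- Symmetry of the form persists at all points near z and can therefore be differentiated. -/
theorem fderiv_fundForm_symm (h : ContDiffAt ℝ ∞ ℓ z) (w : E × E) (c d : E) :
    fderiv ℝ (fundForm ℓ) z w c d = fderiv ℝ (fundForm ℓ) z w d c := by
  have h1 : HasFDerivAt (fundForm ℓ) (fderiv ℝ (fundForm ℓ) z) z :=
    ((contDiffAt_fundForm h).differentiableAt (by norm_cast)).hasFDerivAt
  have h3 := (h1.clm_apply (hasFDerivAt_const c z)).clm_apply (hasFDerivAt_const d z)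
  have h4 := (h1.clm_apply (hasFDerivAt_const d z)).clm_apply (hasFDerivAt_const c z)
  have h5 : (fun x => fundForm ℓ x c d) =ᶠ[𝓝 z] fun x => fundForm ℓ x d c := by
    have hd : ∀ᶠ z' in 𝓝 z, ContDiffAt ℝ 3 ℓ z' :=
      (h.of_le (m := 3) (by norm_cast)).eventually (by norm_cast)
    filter_upwards [hd] with x hx
    rw [fundForm_apply, fundForm_apply,
      (hx.isSymmSndFDerivAt (by simp [minSmoothness_of_isRCLikeNormedField]; norm_cast)).eq]
  have := DFunLike.congr_fun (h3.unique (h4.congr_of_eventuallyEq h5)) w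
  simpa using this

/-- Schwarz for the first derivative of ℓ: the two outermost differentiations of the third
derivative commute. -/
theorem fderiv_fundForm_cartan_symm (h : ContDiffAt ℝ ∞ ℓ z) (a c d : E) :
    fderiv ℝ (fundForm ℓ) z (0, a) c d = fderiv ℝ (fundForm ℓ) z (0, c) a d := by
  rw [fderiv_fundForm_apply h, fderiv_fundForm_apply h,
    ((h.fderiv_right (m := ∞) (by norm_cast)).isSymmSndFDerivAt
      (by simp [minSmoothness_of_isRCLikeNormedField]; norm_cast)).eq]

/-- The fundamental form of a positively `2`-homogeneous function is positively `0`-homogeneous. -/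
theorem fundForm_smul (h : ContDiffAt ℝ ∞ ℓ z) {t : ℝ} (ht0 : 0 < t)
    (ht : ContDiffAt ℝ 3 ℓ (z.1, t • z.2))
    (hh : ∀ᶠ z' in 𝓝 z, ℓ (z'.1, t • z'.2) = t ^ 2 * ℓ z') (c d : E) :
    fundForm ℓ (z.1, t • z.2) c d = fundForm ℓ z c d := by
  -- T is the dilation of the fibre by t, kept opaque as a linear map so that the relation ℓ ∘ T =
  -- t²ℓ can be differentiated twice by the chain rule.
  obtain ⟨T, hT⟩ : ∃ T : E × E →L[ℝ] E × E, ∀ x, T x = (x.1, t • x.2) :=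
    ⟨(ContinuousLinearMap.fst ℝ E E).prod (t • ContinuousLinearMap.snd ℝ E E), fun x => rfl⟩
  simp only [← hT] at ht hh ⊢
  have hs : ∀ᶠ x in 𝓝 z, ContDiffAt ℝ 3 ℓ x :=
    (h.of_le (m := 3) (by norm_cast)).eventually (by norm_cast)
  have hs' : ∀ᶠ x in 𝓝 z, ContDiffAt ℝ 3 ℓ (T x) :=
    (T).continuous.continuousAt.eventually (ht.eventually (by norm_cast))
  have h1 : ∀ᶠ x in 𝓝 z, ∀ w, fderiv ℝ ℓ (T x) (T w) = t ^ 2 * fderiv ℝ ℓ x w := by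
    filter_upwards [hh.eventually_nhds, hs', hs] with x hx hx1 hx2 w
    have h2 := ((hx1.differentiableAt (by norm_cast)).hasFDerivAt.comp x (T).hasFDerivAt)
    have h3 := (hx2.differentiableAt (by norm_cast)).hasFDerivAt.const_mul (t ^ 2)
    have h4 := DFunLike.congr_fun (h2.unique (h3.congr_of_eventuallyEq hx)) w
    simpa using h4
  have h5 := (((ht.fderiv_right (m := 2) (by norm_cast)).differentiableAt
    (by norm_cast)).hasFDerivAt.comp z (T).hasFDerivAt).clm_apply
      (hasFDerivAt_const (T (0, d)) z)
  have h6 := ((((h.fderiv_right (m := 2) (by norm_cast)).differentiableAt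
    (by norm_cast)).hasFDerivAt.clm_apply (hasFDerivAt_const ((0, d) : E × E) z)).const_mul
      (t ^ 2))
  have h7 := DFunLike.congr_fun (h5.unique (h6.congr_of_eventuallyEq
    (h1.mono fun x hx => hx (0, d)))) (0, c)
  -- On vertical vectors T is multiplication by t; two such arguments give the factor t² that
  -- cancels the one from homogeneity.
  have h8 : ∀ a : E, T (0, a) = t • ((0, a) : E × E) := fun a => by simp [hT]
  simp only [_root_.add_apply, ContinuousLinearMap.comp_apply, ContinuousLinearMap.flip_apply,
    _root_.zero_apply, map_zero, zero_add, h8, map_smul, _root_.smul_apply, smul_eq_mul] at h7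
  rw [fundForm_apply, fundForm_apply]
  have : t ^ 2 ≠ 0 := by positivity
  have h9 : t ^ 2 * fderiv ℝ (fderiv ℝ ℓ) (T z) (0, c) (0, d)
    = t ^ 2 * fderiv ℝ (fderiv ℝ ℓ) z (0, c) (0, d) := by rw [← h7]; ring
  rw [mul_left_cancel₀ this h9]

/-- Euler's relation for the fundamental form. -/
theorem fderiv_fundForm_self (h : ContDiffAt ℝ ∞ ℓ z)
    (hh : ∀ c : ℝ, 0 < c → ∀ᶠ z' in 𝓝 z, ℓ (z'.1, c • z'.2) = c ^ 2 * ℓ z')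
    (c d : E) : fderiv ℝ (fundForm ℓ) z (0, z.2) c d = 0 := by
  have hline : HasDerivAt (fun t : ℝ => (z.1, t • z.2)) (0, z.2) 1 := by
    have h2 : HasDerivAt (fun t : ℝ => t • z.2) z.2 1 := by
      simpa using (hasDerivAt_id (1 : ℝ)).smul_const z.2
    exact (hasDerivAt_const 1 z.1).prodMk h2
  have hs : ∀ᶠ x in 𝓝 z, ContDiffAt ℝ 3 ℓ x :=
    (h.of_le (m := 3) (by norm_cast)).eventually (by norm_cast)
  have hcont : Filter.Tendsto (fun t : ℝ => (z.1, t • z.2)) (𝓝 1) (𝓝 z) := by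
    have := hline.continuousAt
    rwa [ContinuousAt, one_smul] at this
  -- The form is constant along the ray t ↦ (x, t y); its derivative at t = 1 is the one in the
  -- direction (0, y).
  have hev : ∀ᶠ t : ℝ in 𝓝 1, fundForm ℓ (z.1, t • z.2) c d = fundForm ℓ z c d := by
    filter_upwards [hcont.eventually hs, lt_mem_nhds (zero_lt_one (α := ℝ))] with t ht ht0
    exact fundForm_smul h ht0 ht (hh t ht0) c d
  have h2 : HasFDerivAt (fun x => fundForm ℓ x c d)
      (((ContinuousLinearMap.apply ℝ ℝ d).comp (ContinuousLinearMap.apply ℝ (E →L[ℝ] ℝ) c)).comp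
        (fderiv ℝ (fundForm ℓ) z)) (z.1, (1 : ℝ) • z.2) := by
    rw [one_smul]
    exact ((ContinuousLinearMap.apply ℝ ℝ d).comp
      (ContinuousLinearMap.apply ℝ (E →L[ℝ] ℝ) c)).hasFDerivAt.comp z
      ((contDiffAt_fundForm h).differentiableAt (by norm_cast)).hasFDerivAt
  have h3 := h2.comp_hasDerivAt (1 : ℝ) hline
  exact h3.unique ((hasDerivAt_const (1 : ℝ) (fundForm ℓ z c d)).congr_of_eventuallyEq hev)

end FundamentalForm

/-! ### From arrays of symbols to linear and bilinear maps, and back to lowered-index identities. -/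

section Symbols

variable {n : ℕ}

local notation "𝔼" => EuclideanSpace ℝ (Fin n)

theorem toLp_eq_sum_single (f : Fin n → ℝ) :
    (WithLp.toLp 2 f : 𝔼) = ∑ i, f i • EuclideanSpace.single i (1 : ℝ) := by
  ext i; simp [Finset.sum_apply, Pi.single_apply]

theorem eq_sum_single (c : 𝔼) : c = ∑ i, c i • EuclideanSpace.single i (1 : ℝ) :=
  toLp_eq_sum_single c.ofLp

/-- Two linear maps which agree on the standard basis are equal. -/
theorem apply_eq_of_single {F : Type*} [AddCommGroup F] [Module ℝ F] {f g : 𝔼 →ₗ[ℝ] F}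
    (h : ∀ i, f (EuclideanSpace.single i 1) = g (EuclideanSpace.single i 1)) (c : 𝔼) :
    f c = g c := by
  rw [eq_sum_single c]
  simp [h]

/-- Two trilinear forms which agree on the standard basis are equal. -/
theorem apply_eq_of_single₃ {f g : 𝔼 → 𝔼 → 𝔼 → ℝ}
    (hf₁ : ∀ c d, IsLinearMap ℝ fun b => f b c d) (hf₂ : ∀ b d, IsLinearMap ℝ fun c => f b c d)
    (hf₃ : ∀ b c, IsLinearMap ℝ fun d => f b c d)
    (hg₁ : ∀ c d, IsLinearMap ℝ fun b => g b c d) (hg₂ : ∀ b d, IsLinearMap ℝ fun c => g b c d)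
    (hg₃ : ∀ b c, IsLinearMap ℝ fun d => g b c d)
    (h : ∀ i j k, f (EuclideanSpace.single i 1) (EuclideanSpace.single j 1)
      (EuclideanSpace.single k 1) = g (EuclideanSpace.single i 1) (EuclideanSpace.single j 1)
      (EuclideanSpace.single k 1)) (b c d : 𝔼) : f b c d = g b c d :=
  apply_eq_of_single (f := (hf₁ c d).mk') (g := (hg₁ c d).mk') (fun i =>
    apply_eq_of_single (f := (hf₂ _ d).mk') (g := (hg₂ _ d).mk') (fun j =>
      apply_eq_of_single (f := (hf₃ _ _).mk') (g := (hg₃ _ _).mk') (fun k => h i j k) d) c) b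

/-- The linear map with matrix `N`. -/
def coeffMap (N : Fin n → Fin n → ℝ) : 𝔼 →ₗ[ℝ] 𝔼 where
  toFun c := WithLp.toLp 2 fun i => ∑ j, N i j * c j
  map_add' c d := by ext i; simp [mul_add, Finset.sum_add_distrib]
  map_smul' a c := by
    ext i; simp only [PiLp.smul_apply, smul_eq_mul, RingHom.id_apply, Finset.mul_sum]
    exact Finset.sum_congr rfl fun j _ => by ring

theorem coeffMap_apply (N : Fin n → Fin n → ℝ) (c : 𝔼) (i : Fin n) :
    coeffMap N c i = ∑ j, N i j * c j := rfl

theorem coeffMap_single (N : Fin n → Fin n → ℝ) (j : Fin n) :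
    coeffMap N (EuclideanSpace.single j 1) = WithLp.toLp 2 fun i => N i j := by
  ext i; simp [coeffMap_apply]

/-- The bilinear map with symbols `Γ`. -/
def symbolMap (Γ : Fin n → Fin n → Fin n → ℝ) : 𝔼 →ₗ[ℝ] 𝔼 →ₗ[ℝ] 𝔼 :=
  LinearMap.mk₂ ℝ (fun c d => WithLp.toLp 2 fun i => ∑ j, ∑ k, Γ i j k * c j * d k)
    (fun c c' d => by ext i; simp [mul_add, add_mul, Finset.sum_add_distrib])
    (fun a c d => by
      ext i; simp only [PiLp.smul_apply, smul_eq_mul, Finset.mul_sum]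
      exact Finset.sum_congr rfl fun j _ => Finset.sum_congr rfl fun k _ => by ring)
    (fun c d d' => by ext i; simp [mul_add, Finset.sum_add_distrib])
    (fun a c d => by
      ext i; simp only [PiLp.smul_apply, smul_eq_mul, Finset.mul_sum]
      exact Finset.sum_congr rfl fun j _ => Finset.sum_congr rfl fun k _ => by ring)

theorem symbolMap_apply (Γ : Fin n → Fin n → Fin n → ℝ) (c d : 𝔼) (i : Fin n) :
    symbolMap Γ c d i = ∑ j, ∑ k, Γ i j k * c j * d k := rfl

theorem symbolMap_single_left (Γ : Fin n → Fin n → Fin n → ℝ) (j : Fin n) (d : 𝔼) :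
    symbolMap Γ (EuclideanSpace.single j 1) d = WithLp.toLp 2 fun i => ∑ k, Γ i j k * d k := by
  ext i
  rw [symbolMap_apply, Finset.sum_eq_single j]
  · simp
  · intro b _ hb; simp [hb]
  · simp

theorem symbolMap_single (Γ : Fin n → Fin n → Fin n → ℝ) (j k : Fin n) :
    symbolMap Γ (EuclideanSpace.single j 1) (EuclideanSpace.single k 1)
      = WithLp.toLp 2 fun i => Γ i j k := by
  rw [symbolMap_single_left]
  ext i
  simp

namespace MetricJet

variable (m : MetricJet (EuclideanSpace ℝ (Fin n)))

/-- The matrix of the fundamental tensor. -/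
def mat : Matrix (Fin n) (Fin n) ℝ :=
  Matrix.of fun i j => m.G (EuclideanSpace.single i 1) (EuclideanSpace.single j 1)

/-- A vector in the kernel of the matrix would be orthogonal to every basis vector, hence zero. -/
theorem det_mat_ne_zero : m.mat.det ≠ 0 := by
  intro h
  obtain ⟨x, hx, hx0⟩ := Matrix.exists_mulVec_eq_zero_iff.2 h
  refine hx ?_
  have h1 : (WithLp.toLp 2 x : 𝔼) = 0 := by
    refine m.nondegenerate _ fun w => ?_
    rw [m.symm]
    refine apply_eq_of_single (f := ((m.G.flip (WithLp.toLp 2 x)) : 𝔼 →ₗ[ℝ] ℝ)) (g := 0)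
      (fun i => ?_) w
    have := congrFun hx0 i
    simp only [Matrix.mulVec, dotProduct, mat, Matrix.of_apply, Pi.zero_apply] at this
    change m.G (EuclideanSpace.single i 1) (WithLp.toLp 2 x) = 0
    rw [toLp_eq_sum_single, ← this]
    simp only [map_sum, map_smul, smul_eq_mul]
    exact Finset.sum_congr rfl fun j _ => mul_comm (x j) _
  simpa using congrArg WithLp.ofLp h1

/-- Raising an index and lowering it again: the bridge from coordinate formulas with gⁱˡ to the
lowered-index characterizations. -/
theorem G_inv_mat (R : Fin n → ℝ) (k : Fin n) :
    m.G (WithLp.toLp 2 fun i => ∑ l, m.mat⁻¹ i l * R l) (EuclideanSpace.single k 1) = R k := by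
  have h1 : m.mat.mulVec (m.mat⁻¹.mulVec R) = R := by
    rw [Matrix.mulVec_mulVec, Matrix.mul_nonsing_inv _ (isUnit_iff_ne_zero.2 m.det_mat_ne_zero),
      Matrix.one_mulVec]
  rw [m.symm, toLp_eq_sum_single]
  simp only [map_sum, map_smul, smul_eq_mul]
  refine Eq.trans (Finset.sum_congr rfl fun i _ => mul_comm _ _) (congrFun h1 k)

/-- Both sides are trilinear, because h ↦ (h, -N h) is linear for linear N, so it suffices to
compare them on basis vectors, where `G_inv_mat` applies. -/
theorem isChern_of_symbols {N : 𝔼 →ₗ[ℝ] 𝔼} {Γ : Fin n → Fin n → Fin n → ℝ}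
    (h : ∀ i j k, Γ i j k = 1 / 2 * ∑ l, m.mat⁻¹ i l *
      (m.D (EuclideanSpace.single k 1, -N (EuclideanSpace.single k 1))
          (EuclideanSpace.single l 1) (EuclideanSpace.single j 1)
        + m.D (EuclideanSpace.single j 1, -N (EuclideanSpace.single j 1))
          (EuclideanSpace.single l 1) (EuclideanSpace.single k 1)
        - m.D (EuclideanSpace.single l 1, -N (EuclideanSpace.single l 1))
          (EuclideanSpace.single j 1) (EuclideanSpace.single k 1))) :
    m.IsChern N fun j k => symbolMap Γ j k := by
  have hadd : ∀ h h' c d, m.D (h + h', -N (h + h')) c d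
      = m.D (h, -N h) c d + m.D (h', -N h') c d := fun h h' c d => by
    have : ((h + h', -N (h + h')) : 𝔼 × 𝔼) = (h, -N h) + (h', -N h') := by
      ext1 <;> simp [add_comm]
    rw [this, map_add]; rfl
  have hsmul : ∀ (a : ℝ) h c d, m.D (a • h, -N (a • h)) c d = a * m.D (h, -N h) c d :=
    fun a h c d => by
      have : ((a • h, -N (a • h)) : 𝔼 × 𝔼) = a • (h, -N h) := by ext1 <;> simp
      rw [this, map_smul]; rfl
  -- The vector h occurs twice in the horizontal lift; hiding this behind `P` turns linearity in h
  -- into a plain rewrite rule.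
  obtain ⟨P, hP⟩ : ∃ P : 𝔼 → 𝔼 → 𝔼 → ℝ, ∀ h c d, m.D (h, -N h) c d = P h c d :=
    ⟨_, fun _ _ _ => rfl⟩
  have hr : ∀ h c c' d, P h (c + c') d = P h c d + P h c' d := fun h c c' d => by simp [← hP]
  have hr' : ∀ h c d d', P h c (d + d') = P h c d + P h c d' := fun h c c' d => by simp [← hP]
  have ht : ∀ h (a : ℝ) c d, P h (a • c) d = a * P h c d := fun h a c d => by simp [← hP]
  have ht' : ∀ h (a : ℝ) c d, P h c (a • d) = a * P h c d := fun h a c d => by simp [← hP]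
  simp only [hP] at hadd hsmul h
  simp only [IsChern, hP]
  refine apply_eq_of_single₃ ?_ ?_ ?_ ?_ ?_ ?_ fun a b c => ?_
  · exact fun _ _ => ⟨fun _ _ => by simp, fun _ _ => by simp⟩
  · exact fun _ _ => ⟨fun _ _ => by simp, fun _ _ => by simp⟩
  · exact fun _ _ => ⟨fun _ _ => by simp, fun _ _ => by simp⟩
  · exact fun _ _ => ⟨fun _ _ => by simp only [hadd, hr, hr']; ring,
      fun _ _ => by simp only [hsmul, ht, ht', smul_eq_mul]; ring⟩
  · exact fun _ _ => ⟨fun _ _ => by simp only [hadd, hr']; ring,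
      fun _ _ => by simp only [hsmul, ht', smul_eq_mul]; ring⟩
  · exact fun _ _ => ⟨fun _ _ => by simp only [hadd, hr]; ring,
      fun _ _ => by simp only [hsmul, ht, smul_eq_mul]; ring⟩
  · rw [symbolMap_single]
    have h4 : (WithLp.toLp 2 fun i => Γ i a b : 𝔼) = (1 / 2 : ℝ) • WithLp.toLp 2 fun i =>
        ∑ l, m.mat⁻¹ i l *
      (P (EuclideanSpace.single b 1) (EuclideanSpace.single l 1) (EuclideanSpace.single a 1)
        + P (EuclideanSpace.single a 1) (EuclideanSpace.single l 1) (EuclideanSpace.single b 1)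
        - P (EuclideanSpace.single l 1) (EuclideanSpace.single a 1)
          (EuclideanSpace.single b 1)) := by
      ext i; simp only [h]; rfl
    rw [h4, map_smul, _root_.smul_apply, smul_eq_mul, G_inv_mat m]

/-- The formal Christoffel symbols are the Chern symbols of the zero nonlinear connection. -/
theorem isFormalChristoffel_of_isChern {γ : 𝔼 → 𝔼 → 𝔼} (h : m.IsChern 0 γ) :
    m.IsFormalChristoffel γ := fun j k l => by simpa using h j k l

theorem isMetricConnection_of_symbols {γ : 𝔼 → 𝔼 → 𝔼} (hγ : ∀ k, IsLinearMap ℝ fun j => γ j k)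
    {N : Fin n → Fin n → ℝ}
    (h : ∀ i j, N i j = γ (EuclideanSpace.single j 1) m.y i - ∑ l, m.mat⁻¹ i l *
      (1 / 2 * m.D (0, γ m.y m.y) (EuclideanSpace.single l 1) (EuclideanSpace.single j 1))) :
    m.IsMetricConnection γ (coeffMap N) := by
  intro j l
  have hl₁ : IsLinearMap ℝ fun j => m.G (coeffMap N j) l :=
    ⟨fun _ _ => by simp, fun _ _ => by simp⟩
  have hr₁ : IsLinearMap ℝ fun j => m.G (γ j m.y) l - 1 / 2 * m.D (0, γ m.y m.y) l j :=
    ⟨fun _ _ => by simp only [(hγ _).map_add, map_add, _root_.add_apply]; ring,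
      fun _ _ => by simp only [(hγ _).map_smul, map_smul, _root_.smul_apply, smul_eq_mul]; ring⟩
  refine apply_eq_of_single (f := hl₁.mk') (g := hr₁.mk') (fun a => ?_) j
  have hr₂ : IsLinearMap ℝ fun l => m.G (γ (EuclideanSpace.single a 1) m.y) l
      - 1 / 2 * m.D (0, γ m.y m.y) l (EuclideanSpace.single a 1) :=
    ⟨fun _ _ => by simp only [map_add, _root_.add_apply]; ring,
      fun _ _ => by simp only [map_smul, _root_.smul_apply, smul_eq_mul]; ring⟩
  refine apply_eq_of_single (f := (m.G (coeffMap N (EuclideanSpace.single a 1))).toLinearMap)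
    (g := hr₂.mk') (fun b => ?_) l
  change m.G (coeffMap N (EuclideanSpace.single a 1)) (EuclideanSpace.single b 1)
    = m.G (γ (EuclideanSpace.single a 1) m.y) (EuclideanSpace.single b 1)
      - 1 / 2 * m.D (0, γ m.y m.y) (EuclideanSpace.single b 1) (EuclideanSpace.single a 1)
  have h4 : coeffMap N (EuclideanSpace.single a 1) = γ (EuclideanSpace.single a 1) m.y
      - WithLp.toLp 2 fun i => ∑ l, m.mat⁻¹ i l *
        (1 / 2 * m.D (0, γ m.y m.y) (EuclideanSpace.single l 1) (EuclideanSpace.single a 1)) := by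
    rw [coeffMap_single]
    ext i; simp only [h]; rfl
  rw [h4, map_sub, _root_.sub_apply, G_inv_mat m]

end MetricJet

end Symbols

/-- Product rule for the pull-back of a field of bilinear forms; the last two terms, from
differentiating J, become the B-terms of `Transforms.D_eq`. -/
theorem exists_hasFDerivAt_bilin {E F : Type*} [NormedAddCommGroup E] [NormedSpace ℝ E]
    [NormedAddCommGroup F] [NormedSpace ℝ F] {G : F → E →L[ℝ] E →L[ℝ] ℝ}
    {G' : F →L[ℝ] E →L[ℝ] E →L[ℝ] ℝ} {Φ : F → F} {T : F →L[ℝ] F} {J : F → E →L[ℝ] E}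
    {J' : F →L[ℝ] E →L[ℝ] E} {z : F} (hG : HasFDerivAt G G' (Φ z)) (hΦ : HasFDerivAt Φ T z)
    (hJ : HasFDerivAt J J' z) (c d : E) :
    ∃ S : F →L[ℝ] ℝ, HasFDerivAt (fun x => G (Φ x) (J x c) (J x d)) S z ∧ ∀ h, S h =
      G' (T h) (J z c) (J z d) + G (Φ z) (J' h c) (J z d) + G (Φ z) (J z c) (J' h d) := by
  have h0 : HasFDerivAt (fun x => G (Φ x)) (G'.comp T) z :=
    HasFDerivAt.comp (G := E →L[ℝ] E →L[ℝ] ℝ) z hG hΦ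
  have h1 := h0.clm_apply (hJ.clm_apply (hasFDerivAt_const c z))
  have h2 := h1.clm_apply (hJ.clm_apply (hasFDerivAt_const d z))
  exact ⟨_, h2, fun h => by simp; ring⟩

/-! ### The jet of a pseudo-Finsler metric at a vector, and its behaviour under change of charts. -/

section Jets

set_option linter.unusedSectionVars false

variable {n : ℕ} {M : Type*} [TopologicalSpace M] [ChartedSpace (EuclideanSpace ℝ (Fin n)) M]
  [IsManifold (𝓡 n) ∞ M]

local notation "𝔼" => EuclideanSpace ℝ (Fin n)

variable {e e' : Chart n M} {A : Set (TangentBundle (𝓡 n) M)} {L : TangentBundle (𝓡 n) M → ℝ}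
  {v : TangentBundle (𝓡 n) M}

theorem constField_add (e : Chart n M) (c d : EuclideanSpace ℝ (Fin n)) (p : M) :
    constField e (c + d) p = constField e c p + constField e d p :=
  map_add (dchart e p).inverse c d

theorem constField_smul (e : Chart n M) (a : ℝ) (c : EuclideanSpace ℝ (Fin n)) (p : M) :
    constField e (a • c) p = a • constField e c p :=
  map_smul (dchart e p).inverse a c

theorem eventually_param_mem (hA : IsConicDomain A) (he : e ∈ IsManifold.maximalAtlas (𝓡 n) ∞ M)
    (hv : v ∈ A) (hve : v.proj ∈ e.source) :
    ∀ᶠ z in 𝓝 (coord e v), z.1 ∈ e.target ∧ param e z ∈ A :=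
  (eventually_fst_mem_target hve).and
    ((tendsto_param he hve).eventually (hA.isOpen.mem_nhds hv))

/-- The lines defining the fundamental tensor stay in one fibre, and `param e` is linear there. -/
theorem fundTensor_param (hA : IsConicDomain A) (hL : IsPseudoFinsler A L)
    (he : e ∈ IsManifold.maximalAtlas (𝓡 n) ∞ M) {z : 𝔼 × 𝔼} (hz : z.1 ∈ e.target)
    (hzA : param e z ∈ A) (c d : 𝔼) :
    fundTensor L (param e z) (constField e c (e.symm z.1)) (constField e d (e.symm z.1))
      = fundForm (fun z => L (param e z)) z c d := by
  have h1 := hL.smooth.contDiffAt hA.isOpen he hzA (e.map_target hz)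
  rw [coord_param he hz] at h1
  rw [← deriv_deriv_eq_fundForm h1]
  unfold fundTensor
  simp only [param, constField_add, constField_smul]
  rfl

theorem fundTensor_eq (hA : IsConicDomain A) (hL : IsPseudoFinsler A L)
    (he : e ∈ IsManifold.maximalAtlas (𝓡 n) ∞ M) (hv : v ∈ A) (hve : v.proj ∈ e.source)
    (u w : TangentSpace (𝓡 n) v.proj) :
    fundTensor L v u w
      = fundForm (fun z => L (param e z)) (coord e v) (dchart e v.proj u) (dchart e v.proj w) := by
  rw [← fundTensor_param hA hL he (e.map_source hve) (by rwa [param_coord he hve])]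
  have key : ∀ v' : TangentBundle (𝓡 n) M, v' = v → fundTensor L v u w
      = fundTensor L v' (constField e (dchart e v.proj u) v'.proj)
        (constField e (dchart e v.proj w) v'.proj) := by
    rintro v' rfl
    rw [constField_dchart he hve, constField_dchart he hve]
  exact key _ (param_coord he hve)

/-- The fundamental tensor and its differential at `v`, in the chart `e`. -/
def jet (hA : IsConicDomain A) (hL : IsPseudoFinsler A L)
    (he : e ∈ IsManifold.maximalAtlas (𝓡 n) ∞ M) (hv : v ∈ A) (hve : v.proj ∈ e.source) :
    MetricJet (EuclideanSpace ℝ (Fin n)) where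
  y := (coord e v).2
  G := fundForm (fun z => L (param e z)) (coord e v)
  D := fderiv ℝ (fundForm (fun z => L (param e z))) (coord e v)
  nondegenerate u hu := by
    have h1 := hL.nondegenerate v hv (constField e u v.proj) fun w => by
      rw [fundTensor_eq hA hL he hv hve, dchart_constField he hve, hu]
    rw [← dchart_constField he hve u, h1, map_zero]
  symm := fundForm_symm (hL.smooth.contDiffAt hA.isOpen he hv hve)
  D_symm := fderiv_fundForm_symm (hL.smooth.contDiffAt hA.isOpen he hv hve)
  cartan_symm := fderiv_fundForm_cartan_symm (hL.smooth.contDiffAt hA.isOpen he hv hve)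
  cartan_y := fderiv_fundForm_self (hL.smooth.contDiffAt hA.isOpen he hv hve) fun c hc => by
    filter_upwards [eventually_param_mem hA he hv hve] with z hz
    have h1 := hL.homogeneous _ hz.2 c hc
    rw [← h1]
    simp only [param, constField_smul]
    rfl

variable (hA : IsConicDomain A) (hL : IsPseudoFinsler A L)
  (he : e ∈ IsManifold.maximalAtlas (𝓡 n) ∞ M) (he' : e' ∈ IsManifold.maximalAtlas (𝓡 n) ∞ M)
  (hv : v ∈ A) (hve : v.proj ∈ e.source) (hve' : v.proj ∈ e'.source)

theorem differentiableAt_fundForm (hA : IsConicDomain A) (hL : IsPseudoFinsler A L)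
    (he : e ∈ IsManifold.maximalAtlas (𝓡 n) ∞ M) (hv : v ∈ A) (hve : v.proj ∈ e.source) :
    DifferentiableAt ℝ (fundForm (fun z => L (param e z))) (coord e v) :=
  (contDiffAt_fundForm (hL.smooth.contDiffAt hA.isOpen he hv hve)).differentiableAt (by norm_cast)

theorem eventually_gMat_param (hA : IsConicDomain A) (hL : IsPseudoFinsler A L)
    (he : e ∈ IsManifold.maximalAtlas (𝓡 n) ∞ M) (hv : v ∈ A) (hve : v.proj ∈ e.source)
    (i j : Fin n) :
    (fun z => gMat L e (param e z) i j) =ᶠ[𝓝 (coord e v)]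
      fun z => fundForm (fun z => L (param e z)) z (EuclideanSpace.single i 1)
        (EuclideanSpace.single j 1) := by
  filter_upwards [eventually_param_mem hA he hv hve] with z hz
  exact fundTensor_param hA hL he hz.1 hz.2 _ _

theorem mat_jet : (jet hA hL he hv hve).mat = gMat L e v := by
  ext i j
  have := (eventually_gMat_param hA hL he hv hve i j).eq_of_nhds
  simp only [param_coord he hve] at this
  exact this.symm

theorem det_gMat_ne_zero (hA : IsConicDomain A) (hL : IsPseudoFinsler A L)
    (he : e ∈ IsManifold.maximalAtlas (𝓡 n) ∞ M) (hv : v ∈ A) (hve : v.proj ∈ e.source) :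
    (gMat L e v).det ≠ 0 := by
  rw [← mat_jet hA hL he hv hve]
  exact MetricJet.det_mat_ne_zero _

theorem hasFDerivAt_gMat (hA : IsConicDomain A) (hL : IsPseudoFinsler A L)
    (he : e ∈ IsManifold.maximalAtlas (𝓡 n) ∞ M) (hv : v ∈ A) (hve : v.proj ∈ e.source)
    (i j : Fin n) :
    ∃ T : 𝔼 × 𝔼 →L[ℝ] ℝ, HasFDerivAt (fun z => gMat L e (param e z) i j) T (coord e v) ∧
      ∀ h, T h = (jet hA hL he hv hve).D h (EuclideanSpace.single i 1)
        (EuclideanSpace.single j 1) := by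
  have h1 := (differentiableAt_fundForm hA hL he hv hve).hasFDerivAt
  have h2 := ((h1.clm_apply (hasFDerivAt_const (EuclideanSpace.single i (1 : ℝ)) _)).clm_apply
    (hasFDerivAt_const (EuclideanSpace.single j (1 : ℝ)) _)).congr_of_eventuallyEq
    (eventually_gMat_param hA hL he hv hve i j)
  exact ⟨_, h2, fun h => by simp [jet]⟩

theorem fderiv_gMat (i j : Fin n) (h : 𝔼 × 𝔼) :
    fderiv ℝ (fun z => gMat L e (param e z) i j) (coord e v) h
      = (jet hA hL he hv hve).D h (EuclideanSpace.single i 1) (EuclideanSpace.single j 1) := by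
  obtain ⟨T, hT, hT'⟩ := hasFDerivAt_gMat hA hL he hv hve i j
  rw [hT.fderiv, hT']

theorem isFormalChristoffel_formalChristoffel : (jet hA hL he hv hve).IsFormalChristoffel
    fun j k => symbolMap (formalChristoffel L e v) j k := by
  refine MetricJet.isFormalChristoffel_of_isChern _
    (MetricJet.isChern_of_symbols (N := 0) _ fun i j k => ?_)
  simp only [formalChristoffel, partialX, mat_jet, LinearMap.zero_apply, neg_zero,
    fderiv_gMat hA hL he hv hve]

theorem isMetricConnection_metricCoeff : (jet hA hL he hv hve).IsMetricConnection
    (fun j k => symbolMap (formalChristoffel L e v) j k) (coeffMap (metricCoeff L e v)) := by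
  refine MetricJet.isMetricConnection_of_symbols _
    (fun k => ⟨fun _ _ => by simp, fun _ _ => by simp⟩) fun i j => ?_
  -- Expanding the spray in the basis recovers the contraction with the Cartan tensor; the ½ is the
  -- one in its definition.
  have hsum : ∀ l, 1 / 2 * (jet hA hL he hv hve).D (0, symbolMap (formalChristoffel L e v)
      (jet hA hL he hv hve).y (jet hA hL he hv hve).y) (EuclideanSpace.single l 1)
      (EuclideanSpace.single j 1) = ∑ k, symbolMap (formalChristoffel L e v)
      (jet hA hL he hv hve).y (jet hA hL he hv hve).y k * cartan L e v l j k := by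
    intro l
    generalize symbolMap (formalChristoffel L e v) (jet hA hL he hv hve).y
      (jet hA hL he hv hve).y = S
    have h1 : ((0, S) : 𝔼 × 𝔼) = ∑ k, S k • ((0, EuclideanSpace.single k 1) : 𝔼 × 𝔼) := by
      ext1
      · simp [Prod.fst_sum]
      · simpa [Prod.snd_sum] using eq_sum_single S
    rw [h1, map_sum]
    simp only [_root_.sum_apply, map_smul, _root_.smul_apply, smul_eq_mul, Finset.mul_sum,
      cartan, partialY, fderiv_gMat hA hL he hv hve]
    exact Finset.sum_congr rfl fun k _ => by ring
  simp only [hsum, mat_jet, symbolMap_single_left, metricCoeff]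
  congr 1
  simp only [symbolMap_apply, Finset.mul_sum, Finset.sum_mul]
  conv_rhs => rw [Finset.sum_comm]
  refine Finset.sum_congr rfl fun k _ => ?_
  conv_rhs => rw [Finset.sum_comm]
  refine Finset.sum_congr rfl fun a _ => ?_
  conv_rhs => rw [Finset.sum_comm]
  refine Finset.sum_congr rfl fun b _ => Finset.sum_congr rfl fun l _ => ?_
  change _ = _ * (formalChristoffel L e v k a b * fib e v a * fib e v b * cartan L e v l j k)
  ring

theorem isChern_chernSymbol : (jet hA hL he hv hve).IsChern (coeffMap (metricCoeff L e v))
    fun j k => symbolMap (chernSymbol L e v) j k := by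
  refine MetricJet.isChern_of_symbols _ fun i j k => ?_
  simp only [chernSymbol, delta_eq, mat_jet, coeffMap_single, fderiv_gMat hA hL he hv hve]

theorem chernSymbol_symm (hA : IsConicDomain A) (hL : IsPseudoFinsler A L)
    (he : e ∈ IsManifold.maximalAtlas (𝓡 n) ∞ M) (hv : v ∈ A) (hve : v.proj ∈ e.source)
    (i j k : Fin n) : chernSymbol L e v i j k = chernSymbol L e v i k j := by
  have h1 := (isChern_chernSymbol hA hL he hv hve).symm (EuclideanSpace.single j 1)
    (EuclideanSpace.single k 1)
  simp only [symbolMap_single] at h1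
  exact congrFun (congrArg WithLp.ofLp h1) i

theorem underlyingCoeff_chernSymbol (hA : IsConicDomain A) (hL : IsPseudoFinsler A L)
    (he : e ∈ IsManifold.maximalAtlas (𝓡 n) ∞ M) (hv : v ∈ A) (hve : v.proj ∈ e.source) :
    underlyingCoeff e (chernSymbol L e) v = metricCoeff L e v := by
  ext i j
  have h1 := (isChern_chernSymbol hA hL he hv hve).apply_y
    (isFormalChristoffel_formalChristoffel hA hL he hv hve)
    (isMetricConnection_metricCoeff hA hL he hv hve) (EuclideanSpace.single j 1)
  simp only [symbolMap_single_left, coeffMap_single] at h1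
  exact congrFun (congrArg WithLp.ofLp h1) i

/-! ### Change of charts -/

/-- The metric in `e` is the pull-back of the metric in `e'` on a whole neighbourhood (`hG`), so the
identity may be differentiated. The value gives `G_eq` and the derivative gives `D_eq`. -/
theorem transforms_jet : (jet hA hL he hv hve).Transforms (jet hA hL he' hv hve')
    (fderiv ℝ (transition e e') (e v.proj)) (fderiv ℝ (fderiv ℝ (transition e e')) (e v.proj)) := by
  have hx : e v.proj ∈ e.target := e.map_source hve
  have hx' : e.symm (e v.proj) ∈ e'.source := by rwa [e.left_inv hve]
  have hc := contDiffAt_transition he he' hx hx'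
  have hJ : fderiv ℝ (transition e e') (e v.proj) = jacobian e e' v.proj := by
    rw [fderiv_transition he he' hx hx', e.left_inv hve]
  have hΦ : transitionTM e e' (coord e v) = coord e' v := transitionTM_coord he he' hve hve'
  have hG : ∀ c d, ∀ᶠ z in 𝓝 (coord e v), fundForm (fun z => L (param e z)) z c d
      = fundForm (fun z => L (param e' z)) (transitionTM e e' z)
        (fderiv ℝ (transition e e') z.1 c) (fderiv ℝ (transition e e') z.1 d) := by
    intro c d
    filter_upwards [eventually_param_mem hA he hv hve,
      continuous_fst.continuousAt.eventually (eventually_mem_overlap hve hve')] with z hz hz'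
    have h1 : (transitionTM e e' z).1 ∈ e'.target := e'.map_source hz'.2
    have hp := param_transitionTM he he' hz'.1 hz'.2
    rw [← fundTensor_param hA hL he hz'.1 hz.2,
      ← fundTensor_param hA hL he' h1 (by rw [hp]; exact hz.2), fderiv_transition he he' hz'.1 hz'.2]
    have key : ∀ v' : TangentBundle (𝓡 n) M, v' = param e z →
        fundTensor L (param e z) (constField e c (e.symm z.1)) (constField e d (e.symm z.1))
        = fundTensor L v' (constField e' (jacobian e e' (e.symm z.1) c) v'.proj)
          (constField e' (jacobian e e' (e.symm z.1) d) v'.proj) := by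
      rintro v' rfl
      change _ = fundTensor L (param e z) (constField e' _ (e.symm z.1))
        (constField e' _ (e.symm z.1))
      rw [constField_jacobian he' hz'.2, constField_jacobian he' hz'.2]
    exact key _ hp
  refine ⟨fun w => ?_, fun h k => ?_, ?_, fun c d => ?_, fun h w c d => ?_⟩
  · exact ⟨jacobian e' e v.proj w, by rw [hJ, jacobian_comp he' he hve' hve]⟩
  · exact (hc.isSymmSndFDerivAt
      (by simp [minSmoothness_of_isRCLikeNormedField]; norm_cast)).eq _ _
  · rw [hJ]
    exact (jacobian_dchart he hve _).symm
  · have := (hG c d).self_of_nhds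
    rw [hΦ] at this
    exact this
  · obtain ⟨T, hT, hT'⟩ := hasFDerivAt_transitionTM he he' (z := coord e v) hx hx'
    have h1 := (((differentiableAt_fundForm hA hL he hv hve).hasFDerivAt.clm_apply
      (hasFDerivAt_const c _)).clm_apply (hasFDerivAt_const d _))
    have h2 : HasFDerivAt (fundForm (fun z => L (param e' z)))
        (fderiv ℝ (fundForm (fun z => L (param e' z))) (coord e' v))
        (transitionTM e e' (coord e v)) := by
      rw [hΦ]; exact (differentiableAt_fundForm hA hL he' hv hve').hasFDerivAt
    have h3 : HasFDerivAt (fun z : 𝔼 × 𝔼 => fderiv ℝ (transition e e') z.1)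
        ((fderiv ℝ (fderiv ℝ (transition e e')) (e v.proj)).comp (ContinuousLinearMap.fst ℝ 𝔼 𝔼))
        (coord e v) := by
      have h6 : HasFDerivAt (fderiv ℝ (transition e e'))
          (fderiv ℝ (fderiv ℝ (transition e e')) (e v.proj)) (coord e v).1 :=
        ((hc.fderiv_right (m := 1) (by norm_cast)).differentiableAt (by norm_cast)).hasFDerivAt
      exact h6.comp (coord e v) hasFDerivAt_fst
    obtain ⟨S, hS, hS'⟩ := exists_hasFDerivAt_bilin h2 hT h3 c d
    have h5 := DFunLike.congr_fun (h1.unique (hS.congr_of_eventuallyEq (hG c d))) (h, w)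
    rw [hS', hT', hΦ] at h5
    simp only [_root_.add_apply, ContinuousLinearMap.comp_apply, ContinuousLinearMap.flip_apply,
      _root_.zero_apply, map_zero, zero_add, ContinuousLinearMap.coe_fst'] at h5
    exact h5

end Jets

/-! ### The covariant derivative of anisotropic fields and its independence of the chart for Chern
symbols. -/

section CovariantDerivative

set_option linter.unusedSectionVars false

variable {n : ℕ} {M : Type*} [TopologicalSpace M] [ChartedSpace (EuclideanSpace ℝ (Fin n)) M]
  [IsManifold (𝓡 n) ∞ M]

local notation "𝔼" => EuclideanSpace ℝ (Fin n)

variable {e e' : Chart n M} {A : Set (TangentBundle (𝓡 n) M)} {L : TangentBundle (𝓡 n) M → ℝ}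
  {v : TangentBundle (𝓡 n) M}
  {Z : ∀ v : TangentBundle (𝓡 n) M, TangentSpace (𝓡 n) v.proj}

theorem delta_comp (N : TangentBundle (𝓡 n) M → Fin n → Fin n → ℝ)
    (hZ : DifferentiableAt ℝ (localRep e Z) (coord e v)) (i j : Fin n) :
    delta e N j (comp e Z i) v = fderiv ℝ (localRep e Z) (coord e v)
      (EuclideanSpace.single j 1, -coeffMap (N v) (EuclideanSpace.single j 1)) i := by
  rw [delta_eq, coeffMap_single]
  have h1 := (EuclideanSpace.proj i : 𝔼 →L[ℝ] ℝ).hasFDerivAt.comp (coord e v) hZ.hasFDerivAt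
  exact DFunLike.congr_fun h1.fderiv _

/-- Assembles the δⱼ into one derivative along the horizontal lift of c. -/
theorem fderiv_horizontal (N : Fin n → Fin n → ℝ) {F : Type*} [NormedAddCommGroup F]
    [NormedSpace ℝ F] (T : 𝔼 × 𝔼 →L[ℝ] F) (c : 𝔼) :
    T (c, -coeffMap N c) = ∑ j, c j •
      T (EuclideanSpace.single j 1, -coeffMap N (EuclideanSpace.single j 1)) := by
  have h : ((c, -coeffMap N c) : 𝔼 × 𝔼) = ∑ j, c j •
      ((EuclideanSpace.single j 1, -coeffMap N (EuclideanSpace.single j 1)) : 𝔼 × 𝔼) := by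
    ext1
    · simpa [Prod.fst_sum] using eq_sum_single c
    · conv_lhs => rw [eq_sum_single c]
      simp [Prod.snd_sum]
  rw [h, map_sum]
  simp only [map_smul]

theorem components_apply (e : Chart n M) (p : M) (u : TangentSpace (𝓡 n) p) (i : Fin n) :
    components e p u i = dchart e p u i := rfl

theorem dchart_coordVec (he : e ∈ IsManifold.maximalAtlas (𝓡 n) ∞ M) {p : M} (hp : p ∈ e.source)
    (i : Fin n) : dchart e p (coordVec e i p) = EuclideanSpace.single i 1 :=
  dchart_constField he hp _

/-- The components of `∇_u Z`. -/
theorem dchart_covVec (he : e ∈ IsManifold.maximalAtlas (𝓡 n) ∞ M) (hve : v.proj ∈ e.source)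
    (Γ : TangentBundle (𝓡 n) M → Fin n → Fin n → Fin n → ℝ)
    (hZ : DifferentiableAt ℝ (localRep e Z) (coord e v)) (u : TangentSpace (𝓡 n) v.proj) :
    dchart e v.proj (covVec e Γ Z v u) =
      fderiv ℝ (localRep e Z) (coord e v)
        (dchart e v.proj u, -coeffMap (underlyingCoeff e Γ v) (dchart e v.proj u))
      + symbolMap (Γ v) (dchart e v.proj u) (localRep e Z (coord e v)) := by
  have h1 : covVec e Γ Z v u = ∑ i, ∑ j, ((delta e (underlyingCoeff e Γ) j (comp e Z i) v
      + ∑ k, Γ v i j k * comp e Z k v) * dchart e v.proj u j) • coordVec e i v.proj := by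
    simp only [covVec, LinearMap.sum_apply, LinearMap.smul_apply, LinearMap.smulRight_apply,
      smul_smul]
    rfl
  rw [h1, map_sum, fderiv_horizontal]
  ext l
  simp only [map_sum, map_smul, dchart_coordVec he hve, localRep_coord he Z hve]
  simp only [WithLp.ofLp_sum, WithLp.ofLp_smul, WithLp.ofLp_add, Finset.sum_apply, Pi.smul_apply, Pi.add_apply, symbolMap_apply,
    smul_eq_mul]
  rw [Finset.sum_eq_single l]
  · simp only [← Finset.sum_add_distrib]
    refine Finset.sum_congr rfl fun j _ => ?_
    rw [delta_comp _ hZ]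
    simp only [PiLp.single_apply, if_true, mul_one, add_mul, Finset.sum_mul]
    congr 1
    · ring
    · exact Finset.sum_congr rfl fun k _ => by simp only [comp]; ring
  · intro i _ hi
    simp [hi.symm]
  · simp

variable (hA : IsConicDomain A) (hL : IsPseudoFinsler A L)
  (he : e ∈ IsManifold.maximalAtlas (𝓡 n) ∞ M) (he' : e' ∈ IsManifold.maximalAtlas (𝓡 n) ∞ M)
  (hv : v ∈ A) (hve : v.proj ∈ e.source) (hve' : v.proj ∈ e'.source)

/-- The Chern covariant derivative does not depend on the chart. -/
theorem covVec_chernSymbol_eq (hA : IsConicDomain A) (hL : IsPseudoFinsler A L)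
    (he : e ∈ IsManifold.maximalAtlas (𝓡 n) ∞ M) (he' : e' ∈ IsManifold.maximalAtlas (𝓡 n) ∞ M)
    (hv : v ∈ A) (hve : v.proj ∈ e.source) (hve' : v.proj ∈ e'.source)
    (hZ : IsAnisoVectorField A Z) :
    covVec e (chernSymbol L e) Z v = covVec e' (chernSymbol L e') Z v := by
  have hd := (hZ.contDiffAt hA.isOpen he hv hve).differentiableAt (by norm_cast)
  have hd' := (hZ.contDiffAt hA.isOpen he' hv hve').differentiableAt (by norm_cast)
  have hx : e v.proj ∈ e.target := e.map_source hve
  have hx' : e.symm (e v.proj) ∈ e'.source := by rwa [e.left_inv hve]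
  have hc := contDiffAt_transition he he' hx hx'
  have hJ : fderiv ℝ (transition e e') (e v.proj) = jacobian e e' v.proj := by
    rw [fderiv_transition he he' hx hx', e.left_inv hve]
  have hT := transforms_jet hA hL he he' hv hve hve'
  have hN := hT.metricConnection (isFormalChristoffel_formalChristoffel hA hL he hv hve)
    (isMetricConnection_metricCoeff hA hL he hv hve)
    (isFormalChristoffel_formalChristoffel hA hL he' hv hve')
    (isMetricConnection_metricCoeff hA hL he' hv hve')
  have hΓ := hT.chern hN (isChern_chernSymbol hA hL he hv hve)
    (isChern_chernSymbol hA hL he' hv hve')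
  refine LinearMap.ext fun u => dchart_injective he' hve' ?_
  rw [dchart_covVec he' hve' _ hd', underlyingCoeff_chernSymbol hA hL he' hv hve']
  rw [← jacobian_dchart (e' := e') he hve (covVec e (chernSymbol L e) Z v u),
    dchart_covVec he hve _ hd, underlyingCoeff_chernSymbol hA hL he hv hve]
  rw [← jacobian_dchart (e' := e') he hve u]
  generalize dchart e v.proj u = c
  have hΦ : transitionTM e e' (coord e v) = coord e' v := transitionTM_coord he he' hve hve'
  have hev : ∀ᶠ z in 𝓝 (coord e v), localRep e' Z (transitionTM e e' z)
      = fderiv ℝ (transition e e') z.1 (localRep e Z z) := by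
    filter_upwards [continuous_fst.continuousAt.eventually (eventually_mem_overlap hve hve')]
      with z hz
    exact localRep_transitionTM he he' Z hz.1 hz.2
  obtain ⟨T, hT, hT'⟩ := hasFDerivAt_transitionTM he he' (z := coord e v) hx hx'
  have h1 : HasFDerivAt (fun z => localRep e' Z (transitionTM e e' z))
      ((fderiv ℝ (localRep e' Z) (coord e' v)).comp T) (coord e v) := by
    have : HasFDerivAt (localRep e' Z) (fderiv ℝ (localRep e' Z) (coord e' v))
        (transitionTM e e' (coord e v)) := by rw [hΦ]; exact hd'.hasFDerivAt
    exact this.comp (coord e v) hT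
  have h3 : HasFDerivAt (fun z : 𝔼 × 𝔼 => fderiv ℝ (transition e e') z.1)
      ((fderiv ℝ (fderiv ℝ (transition e e')) (e v.proj)).comp (ContinuousLinearMap.fst ℝ 𝔼 𝔼))
      (coord e v) := by
    have h6 : HasFDerivAt (fderiv ℝ (transition e e'))
        (fderiv ℝ (fderiv ℝ (transition e e')) (e v.proj)) (coord e v).1 :=
      ((hc.fderiv_right (m := 1) (by norm_cast)).differentiableAt (by norm_cast)).hasFDerivAt
    exact h6.comp (coord e v) hasFDerivAt_fst
  have h4 := h3.clm_apply hd.hasFDerivAt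
  -- The relation Z' ∘ Φ = J Z between local components, differentiated along the horizontal lift of
  -- c. Differentiating J yields B(c, Z), the defect of Γ, and the B(c, y) inside `T` is the defect
  -- of N, so the two laws cancel everything inhomogeneous.
  have h5 := DFunLike.congr_fun (h1.unique (h4.congr_of_eventuallyEq hev))
    (c, -coeffMap (metricCoeff L e v) c)
  have hz := localRep_transitionTM he he' Z (z := coord e v) hx hx'
  rw [hΦ] at hz
  simp only [ContinuousLinearMap.comp_apply, hT', _root_.add_apply,
    ContinuousLinearMap.flip_apply, ContinuousLinearMap.coe_fst'] at h5
  have hN' := hN c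
  have hΓ' := hΓ c (localRep e Z (coord e v))
  have hy : (jet hA hL he hv hve).y = (coord e v).2 := rfl
  have hcx : (coord e v).1 = e v.proj := rfl
  rw [hy] at hN'
  rw [hcx] at hz h5
  rw [hz, map_add, ← hJ, hΓ', ← add_assoc, add_right_comm, ← h5]
  congr 2
  rw [map_neg, hN']
  congr 2
  abel

end CovariantDerivative

/-! ### Determinants: smoothness, traces as derivations, and Jacobi's formula. -/

section MatrixCalculus

variable {n : ℕ} {F : Type*} [NormedAddCommGroup F] [NormedSpace ℝ F]
  {B : F → Matrix (Fin n) (Fin n) ℝ} {z : F}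

theorem contDiffAt_det (h : ∀ i j, ContDiffAt ℝ ∞ (fun x => B x i j) z) :
    ContDiffAt ℝ ∞ (fun x => (B x).det) z := by
  simp only [Matrix.det_apply']
  exact ContDiffAt.sum fun σ _ => contDiffAt_const.mul (contDiffAt_prod fun i _ => h _ _)

theorem contDiffAt_matrix_inv (h : ∀ i j, ContDiffAt ℝ ∞ (fun x => B x i j) z)
    (hd : (B z).det ≠ 0) (i j : Fin n) : ContDiffAt ℝ ∞ (fun x => (B x)⁻¹ i j) z := by
  simp only [Matrix.inv_def, Ring.inverse_eq_inv', Matrix.smul_apply, smul_eq_mul,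
    Matrix.adjugate_apply]
  refine ((contDiffAt_det h).inv hd).mul (contDiffAt_det fun a b => ?_)
  by_cases hj : a = j
  · subst hj; simp only [Matrix.updateRow_self]; exact contDiffAt_const
  · simp only [Matrix.updateRow_ne hj]; exact h a b

/-- Laplace expansion along the replaced row, by Cramer's rule. -/
theorem det_updateRow_eq_sum (W : Matrix (Fin n) (Fin n) ℝ) (i : Fin n) (b : Fin n → ℝ) :
    (W.updateRow i b).det = ∑ j, W.adjugate j i * b j := by
  rw [← Matrix.cramer_transpose_apply, Matrix.cramer_eq_adjugate_mulVec, ← Matrix.adjugate_transpose]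
  rfl

/-- A linear map acts on top-degree forms, as a derivation, by its trace. -/
theorem sum_det_updateRow (W t : Matrix (Fin n) (Fin n) ℝ) :
    ∑ ν, (W.updateRow ν fun i => ∑ j, t i j * W ν j).det = (∑ i, t i i) * W.det := by
  have h := Matrix.adjugate_mul W
  -- Since adj(W) W = det(W)·1, summing over the replaced row leaves only the diagonal of t.
  have h1 : ∀ i j, ∑ ν, W.adjugate i ν * W ν j = if i = j then W.det else 0 := fun i j => by
    have := congrFun (congrFun h i) j
    simpa [Matrix.mul_apply, Matrix.one_apply] using this
  simp only [det_updateRow_eq_sum, Finset.mul_sum]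
  rw [Finset.sum_comm, Finset.sum_mul]
  refine Finset.sum_congr rfl fun i _ => ?_
  rw [Finset.sum_comm]
  calc ∑ j, ∑ ν, W.adjugate i ν * (t i j * W ν j)
      = ∑ j, t i j * ∑ ν, W.adjugate i ν * W ν j := by
        refine Finset.sum_congr rfl fun j _ => ?_
        rw [Finset.mul_sum]
        exact Finset.sum_congr rfl fun ν _ => by ring
    _ = t i i * W.det := by simp [h1]

/-- Jacobi's formula: the determinant is multilinear in the rows, so its derivative replaces one row
at a time. -/
theorem hasFDerivAt_det {B' : Fin n → Fin n → F →L[ℝ] ℝ}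
    (h : ∀ i j, HasFDerivAt (fun x => B x i j) (B' i j) z) :
    ∃ T : F →L[ℝ] ℝ, HasFDerivAt (fun x => (B x).det) T z ∧
      ∀ w, T w = ∑ i, ∑ j, (B z).adjugate j i * B' i j w := by
  let f : ContinuousMultilinearMap ℝ (fun _ : Fin n => Fin n → ℝ) ℝ :=
    { (Matrix.detRowAlternating (n := Fin n) (R := ℝ)).toMultilinearMap with
      cont := Continuous.matrix_det (A := fun X : Fin n → Fin n → ℝ => Matrix.of X)
        continuous_id }
  have h1 : HasFDerivAt (fun x => (fun i j => B x i j : Fin n → Fin n → ℝ))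
      (ContinuousLinearMap.pi fun i => ContinuousLinearMap.pi (B' i)) z :=
    hasFDerivAt_pi.2 fun i => hasFDerivAt_pi.2 fun j => h i j
  have h2 := (f.hasFDerivAt (x := fun i j => B z i j)).comp z h1
  refine ⟨_, h2, fun w => ?_⟩
  rw [ContinuousLinearMap.comp_apply, ContinuousMultilinearMap.linearDeriv_apply]
  exact Finset.sum_congr rfl fun i _ => det_updateRow_eq_sum (B z) i _

/-- The logarithmic derivative of the volume density. -/
theorem hasFDerivAt_sqrt_abs_det {B' : Fin n → Fin n → F →L[ℝ] ℝ}
    (h : ∀ i j, HasFDerivAt (fun x => B x i j) (B' i j) z) (hd : (B z).det ≠ 0) :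
    ∃ T : F →L[ℝ] ℝ, HasFDerivAt (fun x => √|(B x).det|) T z ∧
      ∀ w, T w = √|(B z).det| * (1 / 2 * ∑ i, ∑ j, (B z)⁻¹ j i * B' i j w) := by
  obtain ⟨T, hT, hT'⟩ := hasFDerivAt_det h
  have h0 : HasFDerivAt (fun x => |(B x).det|) ((SignType.sign (B z).det : ℝ) • T) z :=
    HasDerivAt.comp_hasFDerivAt (h₂ := fun t : ℝ => |t|) z (hasDerivAt_abs hd) hT
  have h1 := h0.sqrt (abs_ne_zero.2 hd)
  refine ⟨_, h1, fun w => ?_⟩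
  have h2 : ∑ i, ∑ j, (B z)⁻¹ j i * B' i j w = (B z).det⁻¹ * T w := by
    simp only [hT', Matrix.inv_def, Ring.inverse_eq_inv', Matrix.smul_apply, smul_eq_mul,
      Finset.mul_sum, mul_assoc]
  have h3 : √|(B z).det| ≠ 0 := (Real.sqrt_pos.2 (abs_pos.2 hd)).ne'
  have h4 : √|(B z).det| * √|(B z).det| = |(B z).det| := Real.mul_self_sqrt (abs_nonneg _)
  -- With |d| = sign(d) d and √|d|² = |d|, the chain-rule factor sign(d)/(2√|d|) becomes √|d|/(2d),
  -- so the sign disappears.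
  have h5 : |(B z).det| = SignType.sign (B z).det * (B z).det := (sign_mul_self _).symm
  rw [h2]
  simp only [_root_.smul_apply, smul_eq_mul]
  field_simp
  rw [pow_two, h4, h5]
  ring

end MatrixCalculus

/-! ### Smoothness of the connection coefficients in coordinates. -/

section SmoothSymbols

set_option linter.unusedSectionVars false

variable {n : ℕ} {M : Type*} [TopologicalSpace M] [ChartedSpace (EuclideanSpace ℝ (Fin n)) M]
  [IsManifold (𝓡 n) ∞ M]

local notation "𝔼" => EuclideanSpace ℝ (Fin n)

variable {e e' : Chart n M} {A : Set (TangentBundle (𝓡 n) M)} {L : TangentBundle (𝓡 n) M → ℝ}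
  {v : TangentBundle (𝓡 n) M} {f : TangentBundle (𝓡 n) M → ℝ}

/-- The derivative is based at `coord e (param e z)`, which equals z only over the target of the
chart; the identification is therefore made near `coord e v`. -/
theorem contDiffAt_fderiv_param (he : e ∈ IsManifold.maximalAtlas (𝓡 n) ∞ M)
    (hve : v.proj ∈ e.source) (hf : ContDiffAt ℝ ∞ (fun z => f (param e z)) (coord e v))
    (w : 𝔼 × 𝔼) : ContDiffAt ℝ ∞
      (fun z => fderiv ℝ (fun z => f (param e z)) (coord e (param e z)) w) (coord e v) := by
  refine ((hf.fderiv_right (m := ∞) (by norm_cast)).clm_apply contDiffAt_const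
    (g := fun _ => w)).congr_of_eventuallyEq ?_
  filter_upwards [eventually_fst_mem_target hve] with z hz
  rw [coord_param he hz]

theorem contDiffAt_delta {N : TangentBundle (𝓡 n) M → Fin n → Fin n → ℝ}
    (he : e ∈ IsManifold.maximalAtlas (𝓡 n) ∞ M) (hve : v.proj ∈ e.source)
    (hN : ∀ i j, ContDiffAt ℝ ∞ (fun z => N (param e z) i j) (coord e v))
    (hf : ContDiffAt ℝ ∞ (fun z => f (param e z)) (coord e v)) (k : Fin n) :
    ContDiffAt ℝ ∞ (fun z => delta e N k f (param e z)) (coord e v) :=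
  (contDiffAt_fderiv_param he hve hf _).sub
    (ContDiffAt.sum fun j _ => (hN j k).mul (contDiffAt_fderiv_param he hve hf _))

theorem contDiffAt_gMat (hA : IsConicDomain A) (hL : IsPseudoFinsler A L)
    (he : e ∈ IsManifold.maximalAtlas (𝓡 n) ∞ M) (hv : v ∈ A) (hve : v.proj ∈ e.source)
    (i j : Fin n) : ContDiffAt ℝ ∞ (fun z => gMat L e (param e z) i j) (coord e v) :=
  (((contDiffAt_fundForm (hL.smooth.contDiffAt hA.isOpen he hv hve)).clm_apply
    contDiffAt_const).clm_apply contDiffAt_const).congr_of_eventuallyEq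
    (eventually_gMat_param hA hL he hv hve i j)

theorem contDiffAt_gMat_inv (hA : IsConicDomain A) (hL : IsPseudoFinsler A L)
    (he : e ∈ IsManifold.maximalAtlas (𝓡 n) ∞ M) (hv : v ∈ A) (hve : v.proj ∈ e.source)
    (i j : Fin n) : ContDiffAt ℝ ∞ (fun z => (gMat L e (param e z))⁻¹ i j) (coord e v) :=
  contDiffAt_matrix_inv (contDiffAt_gMat hA hL he hv hve)
    (by rw [param_coord he hve]; exact det_gMat_ne_zero hA hL he hv hve) i j

theorem contDiffAt_fib (he : e ∈ IsManifold.maximalAtlas (𝓡 n) ∞ M) (hve : v.proj ∈ e.source)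
    (i : Fin n) : ContDiffAt ℝ ∞ (fun z => fib e (param e z) i) (coord e v) := by
  have h1 : ContDiffAt ℝ ∞ (fun z : 𝔼 × 𝔼 => z.2 i) (coord e v) :=
    ((EuclideanSpace.proj i : 𝔼 →L[ℝ] ℝ).contDiff.comp contDiff_snd).contDiffAt
  refine h1.congr_of_eventuallyEq ?_
  filter_upwards [eventually_fst_mem_target hve] with z hz
  have := coord_param he hz
  exact congrArg (fun x : 𝔼 × 𝔼 => x.2 i) this

theorem contDiffAt_metricCoeff (hA : IsConicDomain A) (hL : IsPseudoFinsler A L)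
    (he : e ∈ IsManifold.maximalAtlas (𝓡 n) ∞ M) (hv : v ∈ A) (hve : v.proj ∈ e.source)
    (i j : Fin n) : ContDiffAt ℝ ∞ (fun z => metricCoeff L e (param e z) i j) (coord e v) := by
  have hg := contDiffAt_gMat_inv hA hL he hv hve
  have hd : ∀ a b w, ContDiffAt ℝ ∞ (fun z => fderiv ℝ (fun z => gMat L e (param e z) a b)
      (coord e (param e z)) w) (coord e v) := fun a b w =>
    contDiffAt_fderiv_param (f := fun v => gMat L e v a b) he hve
      (contDiffAt_gMat hA hL he hv hve a b) w
  have hγ : ∀ i j k, ContDiffAt ℝ ∞ (fun z => formalChristoffel L e (param e z) i j k)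
      (coord e v) := fun i j k =>
    contDiffAt_const.mul (ContDiffAt.sum fun c _ =>
      (hg i c).mul (((hd _ _ _).add (hd _ _ _)).sub (hd _ _ _)))
  have hC : ∀ i j k, ContDiffAt ℝ ∞ (fun z => cartan L e (param e z) i j k)
      (coord e v) := fun i j k => contDiffAt_const.mul (hd _ _ _)
  have hf := contDiffAt_fib he hve
  exact (ContDiffAt.sum fun k _ => (hγ i j k).mul (hf k)).sub
    (ContDiffAt.sum fun k _ => ContDiffAt.sum fun a _ => ContDiffAt.sum fun b _ =>
      (((ContDiffAt.sum fun l _ => (hg i l).mul (hC l j k)).mul (hγ k a b)).mul (hf a)).mul (hf b))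

theorem contDiffAt_chernSymbol (hA : IsConicDomain A) (hL : IsPseudoFinsler A L)
    (he : e ∈ IsManifold.maximalAtlas (𝓡 n) ∞ M) (hv : v ∈ A) (hve : v.proj ∈ e.source)
    (i j k : Fin n) : ContDiffAt ℝ ∞ (fun z => chernSymbol L e (param e z) i j k) (coord e v) := by
  have hδ : ∀ a b k, ContDiffAt ℝ ∞ (fun z => delta e (metricCoeff L e) k
      (fun v => gMat L e v a b) (param e z)) (coord e v) := fun a b k =>
    contDiffAt_delta he hve (contDiffAt_metricCoeff hA hL he hv hve)
      (contDiffAt_gMat hA hL he hv hve a b) k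
  exact contDiffAt_const.mul (ContDiffAt.sum fun l _ =>
      (contDiffAt_gMat_inv hA hL he hv hve i l).mul (((hδ _ _ _).add (hδ _ _ _)).sub (hδ _ _ _)))

end SmoothSymbols

/-! ### The metric volume form in arbitrary charts; its Lie and covariant derivatives. -/

section Volume

set_option linter.unusedSectionVars false

variable {n : ℕ} {M : Type*} [TopologicalSpace M] [ChartedSpace (EuclideanSpace ℝ (Fin n)) M]
  [IsManifold (𝓡 n) ∞ M]

local notation "𝔼" => EuclideanSpace ℝ (Fin n)

variable {e e' : Chart n M} {A : Set (TangentBundle (𝓡 n) M)} {L : TangentBundle (𝓡 n) M → ℝ}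
  {v : TangentBundle (𝓡 n) M}
  {Z : ∀ v : TangentBundle (𝓡 n) M, TangentSpace (𝓡 n) v.proj} {o : OrientedAtlas n M}

/-- The matrix of components in the chart `e` of `n` tangent vectors at `p`. -/
def frameMat (e : Chart n M) {p : M} (w : Fin n → TangentSpace (𝓡 n) p) :
    Matrix (Fin n) (Fin n) ℝ :=
  Matrix.of fun ν i => dchart e p (w ν) i

theorem chartVolume_apply (w : Fin n → TangentSpace (𝓡 n) v.proj) :
    chartVolume L e v w = √|(gMat L e v).det| * (frameMat e w).det := rfl

/-- The Jacobian matrix of a change of charts. -/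
def jacobianMat (e e' : Chart n M) (p : M) : Matrix (Fin n) (Fin n) ℝ :=
  Matrix.of fun i j => jacobian e e' p (EuclideanSpace.single j 1) i

theorem det_jacobianMat (e e' : Chart n M) (p : M) :
    (jacobianMat e e' p).det = (jacobian e e' p).det := by
  rw [ContinuousLinearMap.det,
    ← LinearMap.det_toMatrix (EuclideanSpace.basisFun (Fin n) ℝ).toBasis]
  congr 1

theorem jacobian_apply (e e' : Chart n M) (p : M) (c : 𝔼) (i : Fin n) :
    jacobian e e' p c i = ∑ j, jacobianMat e e' p i j * c j := by
  conv_lhs => rw [eq_sum_single c]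
  simp [jacobianMat, mul_comm]

theorem frameMat_eq (he : e ∈ IsManifold.maximalAtlas (𝓡 n) ∞ M) {p : M} (hp : p ∈ e.source)
    (w : Fin n → TangentSpace (𝓡 n) p) :
    frameMat e' w = frameMat e w * (jacobianMat e e' p).transpose := by
  ext ν i
  rw [Matrix.mul_apply, frameMat, Matrix.of_apply, ← jacobian_dchart (e' := e') he hp (w ν),
    jacobian_apply]
  exact Finset.sum_congr rfl fun j _ => mul_comm _ _

theorem gMat_eq (hA : IsConicDomain A) (hL : IsPseudoFinsler A L)
    (he' : e' ∈ IsManifold.maximalAtlas (𝓡 n) ∞ M) (hv : v ∈ A) (hve' : v.proj ∈ e'.source) :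
    gMat L e v = (jacobianMat e e' v.proj).transpose * gMat L e' v * jacobianMat e e' v.proj := by
  ext i j
  have h1 : ∀ u w, fundTensor L v u w = ∑ a, ∑ b, dchart e' v.proj u a * dchart e' v.proj w b
      * gMat L e' v a b := by
    intro u w
    have hg : ∀ a b, gMat L e' v a b = fundForm (fun z => L (param e' z)) (coord e' v)
        (EuclideanSpace.single a 1) (EuclideanSpace.single b 1) := fun a b => by
      change fundTensor L v (coordVec e' a v.proj) (coordVec e' b v.proj) = _
      rw [fundTensor_eq hA hL he' hv hve', dchart_coordVec he' hve', dchart_coordVec he' hve']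
    rw [fundTensor_eq hA hL he' hv hve']
    conv_lhs => rw [eq_sum_single (dchart e' v.proj u), eq_sum_single (dchart e' v.proj w)]
    simp only [map_sum, map_smul, _root_.sum_apply, _root_.smul_apply, smul_eq_mul, hg,
      Finset.mul_sum]
    rw [Finset.sum_comm]
    exact Finset.sum_congr rfl fun a _ => Finset.sum_congr rfl fun b _ => by ring
  change fundTensor L v (coordVec e i v.proj) (coordVec e j v.proj) = _
  rw [h1]
  have h2 : ∀ i a, dchart e' v.proj (coordVec e i v.proj) a = jacobianMat e e' v.proj a i :=
    fun i a => rfl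
  simp only [h2, Matrix.mul_apply, Matrix.transpose_apply, Finset.sum_mul]
  rw [Finset.sum_comm]
  exact Finset.sum_congr rfl fun a _ => Finset.sum_congr rfl fun b _ => by ring

/-- With J the Jacobian from `e` to `e'`, the density picks up |det J| (as det g = (det J)² det g')
and the coordinate form picks up det J. Keeping both factors undivided covers either orientation. -/
theorem abs_mul_chartVolume (hA : IsConicDomain A) (hL : IsPseudoFinsler A L)
    (he : e ∈ IsManifold.maximalAtlas (𝓡 n) ∞ M) (he' : e' ∈ IsManifold.maximalAtlas (𝓡 n) ∞ M)
    (hv : v ∈ A) (hve : v.proj ∈ e.source) (hve' : v.proj ∈ e'.source) :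
    (jacobian e e' v.proj).det • chartVolume L e v
      = |(jacobian e e' v.proj).det| • chartVolume L e' v := by
  ext w
  simp only [AlternatingMap.smul_apply, chartVolume_apply, smul_eq_mul]
  rw [gMat_eq (e := e) hA hL he' hv hve', frameMat_eq (e' := e') he hve w, ← det_jacobianMat]
  simp only [Matrix.det_mul, Matrix.det_transpose, abs_mul]
  rw [mul_right_comm |_| _ |_|, Real.sqrt_mul (by positivity), Real.sqrt_mul_self (abs_nonneg _)]
  ring

theorem det_jacobian_ne_zero (he : e ∈ IsManifold.maximalAtlas (𝓡 n) ∞ M)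
    (he' : e' ∈ IsManifold.maximalAtlas (𝓡 n) ∞ M) {p : M} (hp : p ∈ e.source)
    (hp' : p ∈ e'.source) : (jacobian e e' p).det ≠ 0 := by
  intro h
  have h1 : (jacobian e' e p).toLinearMap ∘ₗ (jacobian e e' p).toLinearMap = LinearMap.id :=
    LinearMap.ext fun c => jacobian_comp he he' hp hp' c
  have h2 := congrArg LinearMap.det h1
  rw [LinearMap.det_comp, LinearMap.det_id] at h2
  rw [ContinuousLinearMap.det] at h
  rw [h, mul_zero] at h2
  exact zero_ne_one h2

/-- The metric volume form may be computed in any positively oriented chart. -/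
theorem volumeForm_eq_chartVolume (hA : IsConicDomain A) (hL : IsPseudoFinsler A L)
    (he : e ∈ o.charts) (hv : v ∈ A) (hve : v.proj ∈ e.source) :
    volumeForm o L v = chartVolume L e v := by
  obtain ⟨h1, h2⟩ := (o.cover v.proj).choose_spec
  have h3 := o.compatible e he _ h1 v.proj ⟨hve, h2⟩
  have h4 := abs_mul_chartVolume hA hL (o.smooth he) (o.smooth h1) hv hve h2
  change chartVolume L (o.cover v.proj).choose v = _
  change 0 < (jacobian e (o.cover v.proj).choose v.proj).det at h3
  rw [abs_of_pos h3] at h4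
  exact (smul_right_injective _ h3.ne' h4).symm

/-- In an arbitrary chart, the metric volume form is locally a constant multiple of the volume form
of the chart. -/
theorem exists_volumeForm_eq (o : OrientedAtlas n M) (hA : IsConicDomain A)
    (hL : IsPseudoFinsler A L)
    (he : e ∈ IsManifold.maximalAtlas (𝓡 n) ∞ M) (hv : v ∈ A) (hve : v.proj ∈ e.source) :
    ∃ σ : ℝ, σ ≠ 0 ∧ ∀ᶠ z in 𝓝 (coord e v),
      volumeForm o L (param e z) = σ • chartVolume L e (param e z) := by
  obtain ⟨e₀, he₀, hve₀⟩ := o.cover v.proj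
  have hx : e v.proj ∈ e.target := e.map_source hve
  have hx' : e.symm (e v.proj) ∈ e₀.source := by rwa [e.left_inv hve]
  have hd0 : (jacobian e e₀ v.proj).det ≠ 0 := det_jacobian_ne_zero he (o.smooth he₀) hve hve₀
  have hcont : ContinuousAt (fun z : 𝔼 × 𝔼 => (fderiv ℝ (transition e e₀) z.1).det)
      (coord e v) := by
    have h1 : ContinuousAt (fderiv ℝ (transition e e₀)) (coord e v).1 :=
      ((contDiffAt_transition he (o.smooth he₀) hx hx').fderiv_right (m := 0)
        (by norm_cast)).continuousAt
    exact (ContinuousLinearMap.continuous_det.continuousAt.comp h1).comp continuousAt_fst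
  have hval : (fderiv ℝ (transition e e₀) (coord e v).1).det = (jacobian e e₀ v.proj).det := by
    rw [coord, fderiv_transition he (o.smooth he₀) hx hx', e.left_inv hve]
  -- The sign of a nonvanishing continuous determinant is locally constant; σ is this sign. The
  -- chart domain may be disconnected, so the claim is only local.
  have hsign : ∀ᶠ z : 𝔼 × 𝔼 in 𝓝 (coord e v),
      SignType.sign (fderiv ℝ (transition e e₀) z.1).det
        = SignType.sign (jacobian e e₀ v.proj).det := by
    rcases hd0.lt_or_gt with h | h
    · filter_upwards [hcont.eventually (gt_mem_nhds (hval ▸ h))] with z hz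
      rw [sign_neg hz, sign_neg h]
    · filter_upwards [hcont.eventually (lt_mem_nhds (hval ▸ h))] with z hz
      rw [sign_pos hz, sign_pos h]
  refine ⟨(SignType.sign (jacobian e e₀ v.proj).det : ℝ), by
    rcases hd0.lt_or_gt with h | h <;> simp [sign_neg, sign_pos, h], ?_⟩
  filter_upwards [hsign, eventually_param_mem hA he hv hve,
    continuous_fst.continuousAt.eventually (eventually_mem_overlap hve hve₀)] with z h1 h2 h3
  rw [volumeForm_eq_chartVolume hA hL he₀ h2.2 h3.2]
  have h4 := abs_mul_chartVolume hA hL he (o.smooth he₀) h2.2 (e.map_target h3.1) h3.2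
  have h5 := det_jacobian_ne_zero he (o.smooth he₀) (e.map_target h3.1) h3.2
  rw [fderiv_transition he (o.smooth he₀) h3.1 h3.2] at h1
  refine smul_right_injective _ (abs_ne_zero.2 h5) ?_
  refine h4.symm.trans ?_
  simp only [smul_smul]
  rw [← h1, mul_comm, sign_mul_abs]
  rfl

/-- The coordinate frame has identity component matrix, so the value is a nonzero multiple of the
density. This makes the quotient in `divergence` meaningful and allows cancelling `dVol` later. -/
theorem volumeForm_frame_ne_zero (o : OrientedAtlas n M) (hA : IsConicDomain A)
    (hL : IsPseudoFinsler A L)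
    (he : e ∈ IsManifold.maximalAtlas (𝓡 n) ∞ M) (hv : v ∈ A) (hve : v.proj ∈ e.source) :
    volumeForm o L v (fun i => coordVec e i v.proj) ≠ 0 := by
  obtain ⟨σ, hσ, h⟩ := exists_volumeForm_eq o hA hL he hv hve
  have h1 := h.self_of_nhds
  rw [param_coord he hve] at h1
  have h2 : frameMat e (fun i => coordVec e i v.proj) = 1 := by
    ext ν i
    simp [frameMat, dchart_coordVec he hve, Matrix.one_apply, eq_comm]
  rw [h1, AlternatingMap.smul_apply, chartVolume_apply, h2, Matrix.det_one, mul_one]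
  exact smul_ne_zero hσ (Real.sqrt_pos.2 (abs_pos.2 (det_gMat_ne_zero hA hL he hv hve))).ne'

/-- An endomorphism acts on the metric volume form, as a derivation, by its trace. -/
theorem sum_volumeForm_update (o : OrientedAtlas n M) (hA : IsConicDomain A)
    (hL : IsPseudoFinsler A L) (he : e ∈ IsManifold.maximalAtlas (𝓡 n) ∞ M) (hv : v ∈ A)
    (hve : v.proj ∈ e.source) {f : TangentSpace (𝓡 n) v.proj → TangentSpace (𝓡 n) v.proj}
    {t : Matrix (Fin n) (Fin n) ℝ}
    (hf : ∀ u i, dchart e v.proj (f u) i = ∑ j, t i j * dchart e v.proj u j)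
    (w : Fin n → TangentSpace (𝓡 n) v.proj) :
    ∑ ν, volumeForm o L v (Function.update w ν (f (w ν))) = (∑ i, t i i) * volumeForm o L v w := by
  obtain ⟨σ, hσ, h⟩ := exists_volumeForm_eq o hA hL he hv hve
  have h1 := h.self_of_nhds
  rw [param_coord he hve] at h1
  have h2 : ∀ ν, frameMat e (Function.update w ν (f (w ν)))
      = (frameMat e w).updateRow ν fun i => ∑ j, t i j * frameMat e w ν j := by
    intro ν
    ext a i
    by_cases ha : a = ν
    · subst ha; simp only [frameMat, Matrix.of_apply, Function.update_self, hf,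
        Matrix.updateRow_self]
    · simp only [frameMat, Matrix.of_apply, Function.update_of_ne ha, Matrix.updateRow_ne ha]
  simp only [h1, AlternatingMap.smul_apply, chartVolume_apply, h2, smul_eq_mul]
  rw [← Finset.mul_sum, ← Finset.mul_sum, sum_det_updateRow]
  ring

/-- The logarithmic horizontal derivative of the volume density along `Z`. -/
def logVolumeDeriv (L : TangentBundle (𝓡 n) M → ℝ) (e : Chart n M)
    (N : TangentBundle (𝓡 n) M → Fin n → Fin n → ℝ)
    (Z : ∀ v : TangentBundle (𝓡 n) M, TangentSpace (𝓡 n) v.proj)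
    (v : TangentBundle (𝓡 n) M) : ℝ :=
  ∑ k, comp e Z k v * (1 / 2 * ∑ i, ∑ j, (gMat L e v)⁻¹ j i *
    delta e N k (fun v' => gMat L e v' i j) v)

/-- The extended vectors have constant components and σ is locally constant, so only the density is
differentiated. -/
theorem sum_delta_volumeForm (o : OrientedAtlas n M) (hA : IsConicDomain A)
    (hL : IsPseudoFinsler A L) (he : e ∈ IsManifold.maximalAtlas (𝓡 n) ∞ M) (hv : v ∈ A)
    (hve : v.proj ∈ e.source) (N : TangentBundle (𝓡 n) M → Fin n → Fin n → ℝ)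
    (w : Fin n → TangentSpace (𝓡 n) v.proj) :
    ∑ k, comp e Z k v *
        delta e N k (fun v' => volumeForm o L v' (fun ν => extend e v (w ν) v')) v
      = logVolumeDeriv L e N Z v * volumeForm o L v w := by
  obtain ⟨σ, hσ, h⟩ := exists_volumeForm_eq o hA hL he hv hve
  have h1 := h.self_of_nhds
  rw [param_coord he hve] at h1
  choose B' hB hB' using hasFDerivAt_gMat hA hL he hv hve
  have hd : (gMat L e (param e (coord e v))).det ≠ 0 := by
    rw [param_coord he hve]; exact det_gMat_ne_zero hA hL he hv hve
  obtain ⟨T, hT, hT'⟩ := hasFDerivAt_sqrt_abs_det (B := fun z => gMat L e (param e z)) hB hd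
  have h2 : (fun z => volumeForm o L (param e z) (fun ν => extend e v (w ν) (param e z)))
      =ᶠ[𝓝 (coord e v)] fun z => σ * (frameMat e w).det * √|(gMat L e (param e z)).det| := by
    filter_upwards [h, eventually_fst_mem_target hve] with z hz hz1
    rw [hz, AlternatingMap.smul_apply, chartVolume_apply]
    have h3 : frameMat e (fun ν => extend e v (w ν) (param e z)) = frameMat e w := by
      ext ν i
      simp only [frameMat, Matrix.of_apply, extend]
      rw [dchart_constField he (p := (param e z).proj) (e.map_target hz1)]
    rw [h3, smul_eq_mul]
    ring
  have h4 : fderiv ℝ (fun z => volumeForm o L (param e z)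
      (fun ν => extend e v (w ν) (param e z))) (coord e v) = (σ * (frameMat e w).det) • T :=
    ((hT.const_mul _).congr_of_eventuallyEq h2).fderiv
  rw [logVolumeDeriv, Finset.sum_mul]
  refine Finset.sum_congr rfl fun k _ => ?_
  have h5 : ∀ i j, delta e N k (fun v' => gMat L e v' i j) v
      = B' i j (EuclideanSpace.single k 1, -WithLp.toLp 2 fun j => N v j k) := fun i j => by
    rw [delta_eq, (hB i j).fderiv]
  rw [delta_eq, h4, _root_.smul_apply, hT', param_coord he hve, h1]
  simp only [h5, AlternatingMap.smul_apply, chartVolume_apply, smul_eq_mul]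
  ring

theorem localRep_extend (he : e ∈ IsManifold.maximalAtlas (𝓡 n) ∞ M) (hve : v.proj ∈ e.source)
    (u : TangentSpace (𝓡 n) v.proj) :
    localRep e (extend e v u) =ᶠ[𝓝 (coord e v)] fun _ => dchart e v.proj u := by
  filter_upwards [eventually_fst_mem_target hve] with z hz
  exact dchart_constField he (p := e.symm z.1) (e.map_target hz) _

theorem delta_comp_of_eventually_const {N : TangentBundle (𝓡 n) M → Fin n → Fin n → ℝ} {c : 𝔼}
    (h : localRep e Z =ᶠ[𝓝 (coord e v)] fun _ => c) (i j : Fin n) :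
    delta e N j (comp e Z i) v = 0 := by
  have h1 : HasFDerivAt (localRep e Z) (0 : 𝔼 × 𝔼 →L[ℝ] 𝔼) (coord e v) :=
    (hasFDerivAt_const c _).congr_of_eventuallyEq h
  rw [delta_comp N h1.differentiableAt, h1.fderiv]
  rfl

/-- The Lie derivative of the metric volume form in an arbitrary chart. -/
theorem lieForm_volumeForm (o : OrientedAtlas n M) (hA : IsConicDomain A)
    (hL : IsPseudoFinsler A L) (he : e ∈ IsManifold.maximalAtlas (𝓡 n) ∞ M) (hv : v ∈ A)
    (hve : v.proj ∈ e.source) (N : TangentBundle (𝓡 n) M → Fin n → Fin n → ℝ)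
    (w : Fin n → TangentSpace (𝓡 n) v.proj) :
    lieForm e N Z (volumeForm o L) v w
      = (logVolumeDeriv L e N Z v + ∑ i, delta e N i (comp e Z i) v) * volumeForm o L v w := by
  -- For a field with constant components the term Zʲ δⱼXⁱ vanishes, so the bracket is the
  -- endomorphism with matrix -δⱼZⁱ; the sign cancels the minus in `lieForm`.
  have h : ∀ u i, dchart e v.proj (lieVec e N Z (extend e v u) v) i
      = ∑ j, (Matrix.of fun i j => -delta e N j (comp e Z i) v) i j * dchart e v.proj u j := by
    intro u i
    simp only [lieVec, map_sum, map_smul, dchart_coordVec he hve]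
    have h1 : ∀ j, comp e (extend e v u) j v = dchart e v.proj u j := fun j => by
      simp only [comp, extend]; rw [dchart_constField he hve]
    simp only [WithLp.ofLp_sum, WithLp.ofLp_smul, Finset.sum_apply, Pi.smul_apply, smul_eq_mul,
      delta_comp_of_eventually_const (localRep_extend he hve u), h1]
    rw [Finset.sum_eq_single i]
    · simp only [PiLp.single_apply, if_true, mul_one]
      exact Finset.sum_congr rfl fun j _ => by simp only [Matrix.of_apply]; ring
    · intro b _ hb; simp [hb.symm]
    · simp
  rw [lieForm, sum_delta_volumeForm o hA hL he hv hve,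
    sum_volumeForm_update o hA hL he hv hve h]
  simp only [Matrix.of_apply, Finset.sum_neg_distrib]
  ring

/-- The covariant derivative of the metric volume form in an arbitrary chart. -/
theorem covForm_volumeForm (o : OrientedAtlas n M) (hA : IsConicDomain A)
    (hL : IsPseudoFinsler A L) (he : e ∈ IsManifold.maximalAtlas (𝓡 n) ∞ M) (hv : v ∈ A)
    (hve : v.proj ∈ e.source) (Γ : TangentBundle (𝓡 n) M → Fin n → Fin n → Fin n → ℝ)
    (w : Fin n → TangentSpace (𝓡 n) v.proj) :
    covForm e Γ Z (volumeForm o L) v w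
      = (logVolumeDeriv L e (underlyingCoeff e Γ) Z v - ∑ i, ∑ k, Γ v i k i * comp e Z k v)
        * volumeForm o L v w := by
  -- On constant components ∇_Z reduces to Γ(Z, ·), whose trace contracts the upper index with the
  -- last lower one.
  have h : ∀ u i, dchart e v.proj (covVec e Γ (extend e v u) v (Z v)) i
      = ∑ j, (Matrix.of fun i j => ∑ k, Γ v i k j * comp e Z k v) i j * dchart e v.proj u j := by
    intro u i
    have h1 : HasFDerivAt (localRep e (extend e v u)) (0 : 𝔼 × 𝔼 →L[ℝ] 𝔼) (coord e v) :=
      (hasFDerivAt_const _ _).congr_of_eventuallyEq (localRep_extend he hve u)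
    rw [dchart_covVec he hve _ h1.differentiableAt, h1.fderiv, _root_.zero_apply, zero_add,
      (localRep_extend he hve u).eq_of_nhds, symbolMap_apply, Finset.sum_comm]
    refine Finset.sum_congr rfl fun j _ => ?_
    rw [Matrix.of_apply, Finset.sum_mul]
    rfl
  rw [covForm, sum_delta_volumeForm o hA hL he hv hve,
    sum_volumeForm_update o hA hL he hv hve h]
  simp only [Matrix.of_apply]
  ring

end Volume

/-! ### Lie brackets in coordinates, coordinate frames, and the Chern connection. -/

section Connections

set_option linter.unusedSectionVars false

variable {n : ℕ} {M : Type*} [TopologicalSpace M] [ChartedSpace (EuclideanSpace ℝ (Fin n)) M]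
  [IsManifold (𝓡 n) ∞ M]

local notation "𝔼" => EuclideanSpace ℝ (Fin n)

variable {e e' : Chart n M} {A : Set (TangentBundle (𝓡 n) M)} {L : TangentBundle (𝓡 n) M → ℝ}
  {v : TangentBundle (𝓡 n) M}
  {Z : ∀ v : TangentBundle (𝓡 n) M, TangentSpace (𝓡 n) v.proj} {o : OrientedAtlas n M}
  {X Y : ∀ p : M, TangentSpace (𝓡 n) p}

/-! ### Isotropic vector fields in coordinates -/

theorem IsVectorField.contDiffAt_localRep (hX : IsVectorField X)
    (he : e ∈ IsManifold.maximalAtlas (𝓡 n) ∞ M) (hve : v.proj ∈ e.source) :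
    ContDiffAt ℝ ∞ (localRep e fun w => X w.proj) (coord e v) :=
  (hX.isAnisoVectorField Set.univ).contDiffAt isOpen_univ he (Set.mem_univ v) hve

/-- The components of the Lie bracket of vector fields. -/
theorem dchart_mlieBracket (hX : IsVectorField X) (hY : IsVectorField Y)
    (he : e ∈ IsManifold.maximalAtlas (𝓡 n) ∞ M) (hve : v.proj ∈ e.source) (a b : 𝔼) :
    dchart e v.proj (VectorField.mlieBracket (𝓡 n) X Y v.proj)
      = fderiv ℝ (localRep e fun w => Y w.proj) (coord e v) (dchart e v.proj (X v.proj), a)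
        - fderiv ℝ (localRep e fun w => X w.proj) (coord e v) (dchart e v.proj (Y v.proj), b) := by
  let rep : (∀ p : M, TangentSpace (𝓡 n) p) → 𝔼 → 𝔼 := fun X x => dchart e (e.symm x) (X (e.symm x))
  have hrep : ∀ X, IsVectorField X → ContDiffAt ℝ ∞ (rep X) (e v.proj) := fun X hX =>
    (hX.contDiffAt_localRep he hve).comp (e v.proj)
      (contDiffAt_id.prodMk (contDiffAt_const (c := (coord e v).2)))
  -- An isotropic field has components independent of y, so the vertical entries a and b are
  -- arbitrary.
  have hfd : ∀ X, IsVectorField X → ∀ c d : 𝔼,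
      fderiv ℝ (localRep e fun w => X w.proj) (coord e v) (c, d) = fderiv ℝ (rep X) (e v.proj) c := by
    intro X hX c d
    have h1 : HasFDerivAt (rep X) (fderiv ℝ (rep X) (e v.proj)) (coord e v).1 :=
      ((hrep X hX).differentiableAt (by norm_cast)).hasFDerivAt
    have h2 := h1.comp (coord e v) hasFDerivAt_fst
    exact DFunLike.congr_fun h2.fderiv (c, d)
  have hval : ∀ X : ∀ p : M, TangentSpace (𝓡 n) p, ∀ q ∈ e.source, rep X (e q) = dchart e q (X q) := by
    intro X q hq
    have : ∀ q', q' = q → dchart e q' (X q') = dchart e q (X q) := by rintro _ rfl; rfl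
    exact this _ (e.left_inv hq)
  -- Near the point each field is the pull-back of its coordinate representative, so naturality of
  -- the bracket reduces the claim to the model space.
  have hpull : ∀ X : ∀ p : M, TangentSpace (𝓡 n) p,
      X =ᶠ[𝓝 v.proj] VectorField.mpullback (𝓡 n) (𝓡 n) e (rep X) := by
    intro X
    filter_upwards [e.open_source.mem_nhds hve] with q hq
    change X q = constField e (rep X (e q)) q
    rw [hval X q hq, constField_dchart he hq]
  have hmd : ∀ X, IsVectorField X → MDifferentiableAt (𝓡 n) (𝓡 n).tangent
      (fun x => (⟨x, rep X x⟩ : TangentBundle (𝓡 n) 𝔼)) (e v.proj) := fun X hX =>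
    (contMDiffAt_vectorSpace_iff_contDiffAt.2 (hrep X hX)).mdifferentiableAt (by norm_cast)
  have : IsManifold (𝓡 n) (minSmoothness ℝ 2) M := by
    rw [minSmoothness_of_isRCLikeNormedField]
    exact IsManifold.of_le (n := ∞) (by norm_cast)
  rw [(hpull X).mlieBracket_vectorField_eq (hpull Y),
    ← VectorField.mpullback_mlieBracket (n := ∞) (hmd X hX) (hmd Y hY)
      (contMDiffAt_of_mem_maximalAtlas he hve)
      (by simp [minSmoothness_of_isRCLikeNormedField]; norm_cast)]
  refine (dchart_constField he hve _).trans ?_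
  rw [hfd X hX, hfd Y hY, ← hval X _ hve, ← hval Y _ hve]
  have hbr := (VectorField.mlieBracketWithin_univ (I := 𝓡 n) (V := rep X) (W := rep Y)).symm.trans
    (VectorField.mlieBracketWithin_eq_lieBracketWithin.trans VectorField.lieBracketWithin_univ)
  exact congrFun hbr (e v.proj)

section GlobalFrames

variable [T2Space M]

theorem globalCoordVec_spec (he : e ∈ IsManifold.maximalAtlas (𝓡 n) ∞ M) {p : M}
    (hp : p ∈ e.source) (i : Fin n) : IsVectorField (globalCoordVec e p i) ∧
      ∀ᶠ q in 𝓝 p, globalCoordVec e p i q = coordVec e i q :=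
  Classical.epsilon_spec (exists_globalCoordVec he hp i)

theorem localRep_globalCoordVec (he : e ∈ IsManifold.maximalAtlas (𝓡 n) ∞ M)
    (hve : v.proj ∈ e.source) (i : Fin n) :
    localRep e (fun w => globalCoordVec e v.proj i w.proj)
      =ᶠ[𝓝 (coord e v)] fun _ => EuclideanSpace.single i 1 := by
  have h1 : Filter.Tendsto (fun z : 𝔼 × 𝔼 => e.symm z.1) (𝓝 (coord e v)) (𝓝 v.proj) := by
    have h2 := e.continuousAt_symm (e.map_source hve)
    rw [ContinuousAt, e.left_inv hve] at h2
    exact h2.comp (continuous_fst.tendsto (coord e v))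
  filter_upwards [h1.eventually (globalCoordVec_spec he hve i).2, eventually_fst_mem_target hve]
    with z hz hz'
  change dchart e (e.symm z.1) (globalCoordVec e v.proj i (e.symm z.1)) = _
  rw [hz, dchart_coordVec he (e.map_target hz')]

theorem dchart_globalCoordVec (he : e ∈ IsManifold.maximalAtlas (𝓡 n) ∞ M)
    (hve : v.proj ∈ e.source) (i : Fin n) :
    dchart e v.proj (globalCoordVec e v.proj i v.proj) = EuclideanSpace.single i 1 := by
  rw [(globalCoordVec_spec he hve i).2.self_of_nhds, dchart_coordVec he hve]

theorem fderiv_localRep_globalCoordVec (he : e ∈ IsManifold.maximalAtlas (𝓡 n) ∞ M)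
    (hve : v.proj ∈ e.source) (i : Fin n) :
    fderiv ℝ (localRep e fun w => globalCoordVec e v.proj i w.proj) (coord e v) = 0 :=
  ((hasFDerivAt_const _ _).congr_of_eventuallyEq (localRep_globalCoordVec he hve i)).fderiv

/-- The global fields are coordinate fields only near π(v), which is enough because the bracket
depends on germs. -/
theorem mlieBracket_globalCoordVec (he : e ∈ IsManifold.maximalAtlas (𝓡 n) ∞ M)
    (hve : v.proj ∈ e.source) (i j : Fin n) :
    VectorField.mlieBracket (𝓡 n) (globalCoordVec e v.proj i) (globalCoordVec e v.proj j) v.proj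
      = 0 := by
  refine dchart_injective he hve ?_
  rw [dchart_mlieBracket (globalCoordVec_spec he hve i).1 (globalCoordVec_spec he hve j).1 he hve
    0 0, fderiv_localRep_globalCoordVec he hve, fderiv_localRep_globalCoordVec he hve]
  simp

theorem IsSymmetric.christoffel_symm {D : (∀ p : M, TangentSpace (𝓡 n) p) →
      (∀ p : M, TangentSpace (𝓡 n) p) → ∀ v : TangentBundle (𝓡 n) M, TangentSpace (𝓡 n) v.proj}
    (hD : IsSymmetric A D) (he : e ∈ IsManifold.maximalAtlas (𝓡 n) ∞ M) (hv : v ∈ A)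
    (hve : v.proj ∈ e.source) (i j k : Fin n) :
    christoffel D e v i j k = christoffel D e v i k j := by
  have h := hD _ _ (globalCoordVec_spec he hve j).1 (globalCoordVec_spec he hve k).1 v hv
  rw [mlieBracket_globalCoordVec he hve, sub_zero, sub_eq_zero] at h
  simp only [christoffel, comp]
  rw [h]

end GlobalFrames

/-! ### The Chern connection -/

/-- Frees `chern` from its preferred chart, so that one fixed chart can be used on a whole
neighbourhood. -/
theorem chern_eq_covVec (hA : IsConicDomain A) (hL : IsPseudoFinsler A L)
    (he : e ∈ IsManifold.maximalAtlas (𝓡 n) ∞ M) (hv : v ∈ A) (hve : v.proj ∈ e.source)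
    (hY : IsVectorField Y) :
    chern L X Y v = covVec e (chernSymbol L e) (fun w => Y w.proj) v (X v.proj) := by
  have h := covVec_chernSymbol_eq hA hL (IsManifold.chart_mem_maximalAtlas (I := 𝓡 n) v.proj) he hv
    (mem_chart_source _ _) hve (hY.isAnisoVectorField A)
  exact DFunLike.congr_fun h (X v.proj)

/-- The components of the Chern connection. -/
theorem dchart_chern (hA : IsConicDomain A) (hL : IsPseudoFinsler A L)
    (he : e ∈ IsManifold.maximalAtlas (𝓡 n) ∞ M) (hv : v ∈ A) (hve : v.proj ∈ e.source)
    (hY : IsVectorField Y) :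
    dchart e v.proj (chern L X Y v) = fderiv ℝ (localRep e fun w => Y w.proj) (coord e v)
        (dchart e v.proj (X v.proj), -coeffMap (metricCoeff L e v) (dchart e v.proj (X v.proj)))
      + symbolMap (chernSymbol L e v) (dchart e v.proj (X v.proj))
        (dchart e v.proj (Y v.proj)) := by
  rw [chern_eq_covVec hA hL he hv hve hY, dchart_covVec he hve _
    ((hY.contDiffAt_localRep he hve).differentiableAt (by norm_cast)),
    underlyingCoeff_chernSymbol hA hL he hv hve, localRep_coord he (fun w => Y w.proj) hve]

theorem contDiffAt_coeffMap {F : Type*} [NormedAddCommGroup F] [NormedSpace ℝ F] {z : F}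
    {N : F → Fin n → Fin n → ℝ} {c : F → 𝔼} (hN : ∀ i j, ContDiffAt ℝ ∞ (fun x => N x i j) z)
    (hc : ContDiffAt ℝ ∞ c z) : ContDiffAt ℝ ∞ (fun x => coeffMap (N x) (c x)) z := by
  rw [contDiffAt_piLp] at hc ⊢
  simp only [coeffMap_apply]
  exact fun i => ContDiffAt.sum fun j _ => (hN i j).mul (hc j)

theorem contDiffAt_symbolMap {F : Type*} [NormedAddCommGroup F] [NormedSpace ℝ F] {z : F}
    {Γ : F → Fin n → Fin n → Fin n → ℝ} {c d : F → 𝔼}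
    (hΓ : ∀ i j k, ContDiffAt ℝ ∞ (fun x => Γ x i j k) z)
    (hc : ContDiffAt ℝ ∞ c z) (hd : ContDiffAt ℝ ∞ d z) :
    ContDiffAt ℝ ∞ (fun x => symbolMap (Γ x) (c x) (d x)) z := by
  rw [contDiffAt_piLp] at hc hd ⊢
  simp only [symbolMap_apply]
  exact fun i => ContDiffAt.sum fun j _ => ContDiffAt.sum fun k _ =>
    ((hΓ i j k).mul (hc j)).mul (hd k)

/-- The preferred chart may jump from point to point, so smoothness is read from the formula
`dchart_chern` in one chart around v. -/
theorem isAnisoVectorField_chern (hA : IsConicDomain A) (hL : IsPseudoFinsler A L)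
    (hX : IsVectorField X) (hY : IsVectorField Y) : IsAnisoVectorField A (chern L X Y) := by
  refine isAnisoVectorField_of_localRep fun v hv => ?_
  have he := IsManifold.chart_mem_maximalAtlas (I := 𝓡 n) (n := ∞) v.proj
  have hve := mem_chart_source 𝔼 v.proj
  refine ⟨_, he, hve, ?_⟩
  generalize chartAt 𝔼 v.proj = e at he hve
  have hX' := hX.contDiffAt_localRep he hve
  have hY' := hY.contDiffAt_localRep he hve
  have h1 := ((hY'.fderiv_right (m := ∞) (by norm_cast)).clm_apply
    (hX'.prodMk (contDiffAt_coeffMap (contDiffAt_metricCoeff hA hL he hv hve) hX').neg)).add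
    (contDiffAt_symbolMap (contDiffAt_chernSymbol hA hL he hv hve) hX' hY')
  refine h1.congr_of_eventuallyEq ?_
  filter_upwards [eventually_param_mem hA he hv hve] with z hz
  have h2 := dchart_chern hA hL (X := X) he hz.2 (e.map_target hz.1) hY
  rw [coord_param he hz.1] at h2
  exact h2

/-- A function on `M` is constant along the fibres, whence the arbitrary vertical entry a. -/
theorem dirDeriv_eq_fderiv {f : M → ℝ} (hf : ContMDiff (𝓡 n) 𝓘(ℝ, ℝ) ∞ f)
    (he : e ∈ IsManifold.maximalAtlas (𝓡 n) ∞ M) (hve : v.proj ∈ e.source) :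
    ∃ T : 𝔼 × 𝔼 →L[ℝ] ℝ, HasFDerivAt (fun z : 𝔼 × 𝔼 => f (e.symm z.1)) T (coord e v) ∧
      ∀ u a, T (dchart e v.proj u, a) = dirDeriv f v.proj u := by
  have hx : e v.proj ∈ e.target := e.map_source hve
  have h1 : MDifferentiableAt (𝓡 n) 𝓘(ℝ, ℝ) f (e.symm (e v.proj)) :=
    hf.contMDiffAt.mdifferentiableAt (by norm_cast)
  have h2 : MDifferentiableAt (𝓡 n) (𝓡 n) e.symm (e v.proj) :=
    (contMDiffAt_symm_of_mem_maximalAtlas he hx).mdifferentiableAt (by norm_cast : (∞ : ℕ∞ω) ≠ 0)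
  have h3 : DifferentiableAt ℝ (f ∘ e.symm) (coord e v).1 :=
    mdifferentiableAt_iff_differentiableAt.1 (h1.comp _ h2)
  refine ⟨_, h3.hasFDerivAt.comp (coord e v) hasFDerivAt_fst, fun u a => ?_⟩
  change fderiv ℝ (f ∘ e.symm) (e v.proj) (dchart e v.proj u) = _
  rw [← mfderiv_eq_fderiv]
  have h4 := mfderiv_comp (e v.proj) h1 h2
  have h5 := DFunLike.congr_fun h4 (dchart e v.proj u)
  refine h5.trans ?_
  change mfderiv (𝓡 n) 𝓘(ℝ, ℝ) f (e.symm (e v.proj))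
    (mfderiv (𝓡 n) (𝓡 n) e.symm (e v.proj) (dchart e v.proj u)) = _
  rw [← inverse_dchart he hx]
  have key : ∀ q, q = v.proj → mfderiv (𝓡 n) 𝓘(ℝ, ℝ) f q
      ((dchart e q).inverse (dchart e v.proj u)) = dirDeriv f v.proj u := by
    rintro q rfl
    have := constField_dchart he hve u
    rw [constField] at this
    rw [this]; rfl
  exact key _ (e.left_inv hve)

theorem isAnisoConnection_chern (hA : IsConicDomain A) (hL : IsPseudoFinsler A L) :
    IsAnisoConnection A (chern L) where
  smooth X Y hX hY := isAnisoVectorField_chern hA hL hX hY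
  add_left X X' Y _ _ _ v _ := map_add (covVec _ _ _ v) (X v.proj) (X' v.proj)
  smul_left f X Y _ _ _ v _ := map_smul (covVec _ _ _ v) (f v.proj) (X v.proj)
  add_right X Y Y' _ hY hY' v hv := by
    have he := IsManifold.chart_mem_maximalAtlas (I := 𝓡 n) (n := ∞) v.proj
    have hve := mem_chart_source 𝔼 v.proj
    generalize chartAt 𝔼 v.proj = e at he hve
    have hd := (hY.contDiffAt_localRep he hve).differentiableAt (by norm_cast)
    have hd' := (hY'.contDiffAt_localRep he hve).differentiableAt (by norm_cast)
    have h1 : localRep e (fun w => Y w.proj + Y' w.proj)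
        = fun z => localRep e (fun w => Y w.proj) z + localRep e (fun w => Y' w.proj) z :=
      funext fun z => map_add _ _ _
    have hYY : IsVectorField (fun p => Y p + Y' p) := hY.add_section hY'
    refine dchart_injective he hve ?_
    rw [map_add, dchart_chern hA hL he hv hve hY, dchart_chern hA hL he hv hve hY',
      dchart_chern hA hL he hv hve hYY, h1, fderiv_fun_add hd hd', map_add, map_add,
      _root_.add_apply]
    abel
  leibniz f X Y hf _ hY v hv := by
    have he := IsManifold.chart_mem_maximalAtlas (I := 𝓡 n) (n := ∞) v.proj
    have hve := mem_chart_source 𝔼 v.proj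
    generalize chartAt 𝔼 v.proj = e at he hve
    have hd := (hY.contDiffAt_localRep he hve).differentiableAt (by norm_cast)
    obtain ⟨T, hT, hT'⟩ := dirDeriv_eq_fderiv hf he hve
    have h1 : localRep e (fun w => f w.proj • Y w.proj)
        = fun z => f (e.symm z.1) • localRep e (fun w => Y w.proj) z :=
      funext fun z => map_smul _ _ _
    have h2 := hT.fun_smul hd.hasFDerivAt
    have hfY : IsVectorField (fun p => f p • Y p) := hf.smul_section hY
    refine dchart_injective he hve ?_
    rw [map_add, map_smul, map_smul, dchart_chern hA hL he hv hve hY,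
      dchart_chern hA hL he hv hve hfY, h1, h2.fderiv]
    simp only [_root_.add_apply, _root_.smul_apply, ContinuousLinearMap.smulRight_apply, hT',
      localRep_coord he (fun w => Y w.proj) hve, map_smul, smul_add]
    have h3 : e.symm (coord e v).1 = v.proj := e.left_inv hve
    rw [h3]
    abel

/-- The symbol terms cancel by symmetry. The derivative terms form the bracket, whose free vertical
entries absorb the horizontal corrections. -/
theorem isSymmetric_chern (hA : IsConicDomain A) (hL : IsPseudoFinsler A L) :
    IsSymmetric A (chern L) := by
  intro X Y hX hY v hv
  have he := IsManifold.chart_mem_maximalAtlas (I := 𝓡 n) (n := ∞) v.proj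
  have hve := mem_chart_source 𝔼 v.proj
  generalize chartAt 𝔼 v.proj = e at he hve
  refine dchart_injective he hve ?_
  rw [map_sub, map_sub, map_zero, dchart_chern hA hL he hv hve hY, dchart_chern hA hL he hv hve hX,
    dchart_mlieBracket hX hY he hve,
    (isChern_chernSymbol hA hL he hv hve).symm (dchart e v.proj (Y v.proj))]
  abel

/-- The frame fields have constant components near π(v), so the derivative part vanishes and only
the symbols remain. -/
theorem christoffel_chern [T2Space M] (hA : IsConicDomain A) (hL : IsPseudoFinsler A L)
    (he : e ∈ IsManifold.maximalAtlas (𝓡 n) ∞ M) (hv : v ∈ A) (hve : v.proj ∈ e.source)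
    (i j k : Fin n) : christoffel (chern L) e v i j k = chernSymbol L e v i j k := by
  rw [christoffel, comp, dchart_chern hA hL he hv hve (globalCoordVec_spec he hve k).1,
    fderiv_localRep_globalCoordVec he hve, dchart_globalCoordVec he hve,
    dchart_globalCoordVec he hve, symbolMap_single]
  simp

end Connections

/-! ### The divergence as a trace. -/

section Divergence

set_option linter.unusedSectionVars false

variable {n : ℕ} {M : Type*} [TopologicalSpace M] [ChartedSpace (EuclideanSpace ℝ (Fin n)) M]
  [IsManifold (𝓡 n) ∞ M]

local notation "𝔼" => EuclideanSpace ℝ (Fin n)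

variable {e e' : Chart n M} {A : Set (TangentBundle (𝓡 n) M)} {L : TangentBundle (𝓡 n) M → ℝ}
  {v : TangentBundle (𝓡 n) M}
  {Z : ∀ v : TangentBundle (𝓡 n) M, TangentSpace (𝓡 n) v.proj}

theorem delta_congr {N N' : TangentBundle (𝓡 n) M → Fin n → Fin n → ℝ}
    (h : ∀ i j, N v i j = N' v i j) (k : Fin n) (f : TangentBundle (𝓡 n) M → ℝ) :
    delta e N k f v = delta e N' k f v := by
  simp only [delta, h]

theorem logVolumeDeriv_congr {N N' : TangentBundle (𝓡 n) M → Fin n → Fin n → ℝ}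
    (h : ∀ i j, N v i j = N' v i j) :
    logVolumeDeriv L e N Z v = logVolumeDeriv L e N' Z v := by
  simp only [logVolumeDeriv, delta_congr h]

theorem gMat_symm (hA : IsConicDomain A) (hL : IsPseudoFinsler A L)
    (he : e ∈ IsManifold.maximalAtlas (𝓡 n) ∞ M) (hv : v ∈ A) (hve : v.proj ∈ e.source) :
    (gMat L e v).transpose = gMat L e v := by
  ext i j
  rw [Matrix.transpose_apply, ← mat_jet hA hL he hv hve]
  exact (jet hA hL he hv hve).symm _ _

theorem delta_gMat_symm (hA : IsConicDomain A) (hL : IsPseudoFinsler A L)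
    (he : e ∈ IsManifold.maximalAtlas (𝓡 n) ∞ M) (hv : v ∈ A) (hve : v.proj ∈ e.source)
    (N : TangentBundle (𝓡 n) M → Fin n → Fin n → ℝ) (k i j : Fin n) :
    delta e N k (fun v' => gMat L e v' i j) v = delta e N k (fun v' => gMat L e v' j i) v := by
  rw [delta_eq, delta_eq, fderiv_gMat hA hL he hv hve, fderiv_gMat hA hL he hv hve]
  exact (jet hA hL he hv hve).D_symm _ _ _

/-- The traces of the Chern symbols are the logarithmic derivatives of the volume density. -/
theorem sum_chernSymbol (hA : IsConicDomain A) (hL : IsPseudoFinsler A L)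
    (he : e ∈ IsManifold.maximalAtlas (𝓡 n) ∞ M) (hv : v ∈ A) (hve : v.proj ∈ e.source)
    (k : Fin n) : ∑ i, chernSymbol L e v i k i = 1 / 2 * ∑ i, ∑ j, (gMat L e v)⁻¹ j i *
      delta e (metricCoeff L e) k (fun v' => gMat L e v' i j) v := by
  have hinv : ∀ i j, (gMat L e v)⁻¹ i j = (gMat L e v)⁻¹ j i := fun i j => by
    conv_lhs => rw [← gMat_symm hA hL he hv hve, ← Matrix.transpose_nonsing_inv]
    rfl
  -- Under contraction with the symmetric gⁱˡ, the second and third Koszul terms are interchanged by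
  -- renaming i and l, so they cancel.
  have hcancel : ∑ i, ∑ l, (gMat L e v)⁻¹ i l *
        delta e (metricCoeff L e) l (fun v' => gMat L e v' k i) v
      = ∑ i, ∑ l, (gMat L e v)⁻¹ i l *
        delta e (metricCoeff L e) i (fun v' => gMat L e v' l k) v := by
    rw [Finset.sum_comm]
    refine Finset.sum_congr rfl fun i _ => Finset.sum_congr rfl fun l _ => ?_
    rw [hinv l i, delta_gMat_symm hA hL he hv hve _ _ k l]
  simp only [chernSymbol]
  rw [← Finset.mul_sum]
  congr 1
  simp only [mul_add, mul_sub, Finset.sum_add_distrib, Finset.sum_sub_distrib]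
  rw [hcancel, Finset.sum_comm (f := fun i j => (gMat L e v)⁻¹ j i * _)]
  ring

theorem logVolumeDeriv_metricCoeff (hA : IsConicDomain A) (hL : IsPseudoFinsler A L)
    (he : e ∈ IsManifold.maximalAtlas (𝓡 n) ∞ M) (hv : v ∈ A) (hve : v.proj ∈ e.source) :
    logVolumeDeriv L e (metricCoeff L e) Z v
      = ∑ i, ∑ k, chernSymbol L e v i k i * comp e Z k v := by
  rw [Finset.sum_comm, logVolumeDeriv]
  refine Finset.sum_congr rfl fun k _ => ?_
  rw [← sum_chernSymbol hA hL he hv hve, ← Finset.sum_mul, mul_comm]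

theorem trace_covVec (he : e ∈ IsManifold.maximalAtlas (𝓡 n) ∞ M) (hve : v.proj ∈ e.source)
    (Γ : TangentBundle (𝓡 n) M → Fin n → Fin n → Fin n → ℝ) :
    LinearMap.trace ℝ (TangentSpace (𝓡 n) v.proj) (covVec e Γ Z v)
      = ∑ i, delta e (underlyingCoeff e Γ) i (comp e Z i) v
        + ∑ i, ∑ k, Γ v i i k * comp e Z k v := by
  have : FiniteDimensional ℝ (TangentSpace (𝓡 n) v.proj) :=
    inferInstanceAs (FiniteDimensional ℝ 𝔼)
  have h : ∀ i j, LinearMap.trace ℝ (TangentSpace (𝓡 n) v.proj)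
      (((LinearMap.proj j).comp (components e v.proj)).smulRight (coordVec e i v.proj))
        = if j = i then 1 else 0 := by
    intro i j
    rw [LinearMap.trace_smulRight, LinearMap.comp_apply, LinearMap.proj_apply, components_apply,
      dchart_coordVec he hve, PiLp.single_apply]
  simp only [covVec, map_sum, map_smul, h, smul_eq_mul, mul_ite, mul_one, mul_zero,
    Finset.sum_ite_eq', Finset.mem_univ, if_true]
  rw [Finset.sum_add_distrib]

theorem logVolumeDeriv_add_sum_delta_eq_trace (hA : IsConicDomain A) (hL : IsPseudoFinsler A L)
    (he : e ∈ IsManifold.maximalAtlas (𝓡 n) ∞ M) (hv : v ∈ A) (hve : v.proj ∈ e.source) :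
    logVolumeDeriv L e (metricCoeff L e) Z v + ∑ i, delta e (metricCoeff L e) i (comp e Z i) v
      = LinearMap.trace ℝ (TangentSpace (𝓡 n) v.proj) (covVec e (chernSymbol L e) Z v) := by
  have hN : ∀ i j, underlyingCoeff e (chernSymbol L e) v i j = metricCoeff L e v i j := fun i j => by
    rw [underlyingCoeff_chernSymbol hA hL he hv hve]
  rw [trace_covVec he hve, logVolumeDeriv_metricCoeff hA hL he hv hve, add_comm]
  simp only [delta_congr hN]
  congr 1
  exact Finset.sum_congr rfl fun i _ => Finset.sum_congr rfl fun k _ => by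
    rw [chernSymbol_symm hA hL he hv hve]

/-- In the preferred chart this is the coordinate computation; since the endomorphism on the right
is chart-free, the equality passes to every chart. This is where the divergence becomes well
defined. -/
theorem divergence_eq_trace (o : OrientedAtlas n M) (hA : IsConicDomain A)
    (hL : IsPseudoFinsler A L) (hZ : IsAnisoVectorField A Z)
    (he : e ∈ IsManifold.maximalAtlas (𝓡 n) ∞ M) (hv : v ∈ A) (hve : v.proj ∈ e.source) :
    divergence o L Z v
      = LinearMap.trace ℝ (TangentSpace (𝓡 n) v.proj) (covVec e (chernSymbol L e) Z v) := by
  have he' := IsManifold.chart_mem_maximalAtlas (I := 𝓡 n) (n := ∞) v.proj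
  have hve' := mem_chart_source 𝔼 v.proj
  rw [covVec_chernSymbol_eq hA hL he he' hv hve hve' hZ, divergence,
    ← logVolumeDeriv_add_sum_delta_eq_trace hA hL he' hv hve']
  exact (div_eq_iff (volumeForm_frame_ne_zero o hA hL he' hv hve')).2
    (lieForm_volumeForm o hA hL he' hv hve' _ _)

theorem divergence_eq (o : OrientedAtlas n M) (hA : IsConicDomain A)
    (hL : IsPseudoFinsler A L) (hZ : IsAnisoVectorField A Z)
    (he : e ∈ IsManifold.maximalAtlas (𝓡 n) ∞ M) (hv : v ∈ A) (hve : v.proj ∈ e.source) :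
    divergence o L Z v = logVolumeDeriv L e (metricCoeff L e) Z v
      + ∑ i, delta e (metricCoeff L e) i (comp e Z i) v := by
  rw [divergence_eq_trace o hA hL hZ he hv hve, logVolumeDeriv_add_sum_delta_eq_trace hA hL he hv hve]

/-- The divergence in coordinates. -/
theorem divergence_eq_sum (o : OrientedAtlas n M) (hA : IsConicDomain A)
    (hL : IsPseudoFinsler A L) (hZ : IsAnisoVectorField A Z)
    (he : e ∈ IsManifold.maximalAtlas (𝓡 n) ∞ M) (hv : v ∈ A) (hve : v.proj ∈ e.source) :
    divergence o L Z v = ∑ i, delta e (metricCoeff L e) i (comp e Z i) v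
      + ∑ i, ∑ k, chernSymbol L e v i i k * comp e Z k v := by
  rw [divergence_eq o hA hL hZ he hv hve, logVolumeDeriv_metricCoeff hA hL he hv hve, add_comm]
  congr 1
  exact Finset.sum_congr rfl fun i _ => Finset.sum_congr rfl fun k _ => by
    rw [chernSymbol_symm hA hL he hv hve]

/-- The defining property of the divergence, in every chart. -/
theorem lieForm_volumeForm_eq_divergence (o : OrientedAtlas n M) (hA : IsConicDomain A)
    (hL : IsPseudoFinsler A L) (hZ : IsAnisoVectorField A Z)
    (he : e ∈ IsManifold.maximalAtlas (𝓡 n) ∞ M) (hv : v ∈ A) (hve : v.proj ∈ e.source)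
    (w : Fin n → TangentSpace (𝓡 n) v.proj) :
    lieForm e (metricCoeff L e) Z (volumeForm o L) v w
      = divergence o L Z v * volumeForm o L v w := by
  rw [lieForm_volumeForm o hA hL he hv hve, divergence_eq o hA hL hZ he hv hve]

/-- The coordinate formula holds in one fixed chart near v and is smooth there, although the
definition changes chart with the point. -/
theorem isAnisoFunction_divergence (o : OrientedAtlas n M) (hA : IsConicDomain A)
    (hL : IsPseudoFinsler A L) (hZ : IsAnisoVectorField A Z) :
    IsAnisoFunction A (divergence o L Z) := by
  intro v hv
  have he := IsManifold.chart_mem_maximalAtlas (I := 𝓡 n) (n := ∞) v.proj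
  have hve := mem_chart_source 𝔼 v.proj
  generalize chartAt 𝔼 v.proj = e at he hve
  refine (contMDiffAt_of_contDiffAt_param he hve ?_).contMDiffWithinAt
  have hcomp : ∀ i, ContDiffAt ℝ ∞ (fun z => comp e Z i (param e z)) (coord e v) :=
    (contDiffAt_piLp 2).1 (hZ.contDiffAt hA.isOpen he hv hve)
  have h : ContDiffAt ℝ ∞ (fun z => ∑ i, delta e (metricCoeff L e) i (comp e Z i) (param e z)
      + ∑ i, ∑ k, chernSymbol L e (param e z) i i k * comp e Z k (param e z)) (coord e v) :=
    (ContDiffAt.sum fun i _ => contDiffAt_delta he hve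
      (contDiffAt_metricCoeff hA hL he hv hve) (hcomp i) i).add
    (ContDiffAt.sum fun i _ => ContDiffAt.sum fun k _ =>
      (contDiffAt_chernSymbol hA hL he hv hve i i k).mul (hcomp k))
  refine h.congr_of_eventuallyEq ?_
  filter_upwards [eventually_param_mem hA he hv hve] with z hz
  exact divergence_eq_sum o hA hL hZ he hz.2 (e.map_target hz.1)

section Connection

variable [T2Space M]
  {D : (∀ p : M, TangentSpace (𝓡 n) p) → (∀ p : M, TangentSpace (𝓡 n) p) →
    ∀ v : TangentBundle (𝓡 n) M, TangentSpace (𝓡 n) v.proj}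

/-- The divergence through a symmetric connection for which the volume form is parallel. -/
theorem divergence_eq_of_isParallelAlong (o : OrientedAtlas n M) (hA : IsConicDomain A)
    (hL : IsPseudoFinsler A L) (hZ : IsAnisoVectorField A Z) (hD : IsSymmetric A D)
    (hN : HasMetricConnection A L D) (hP : IsParallelAlong A D Z (volumeForm o L))
    (he : e ∈ IsManifold.maximalAtlas (𝓡 n) ∞ M) (hv : v ∈ A) (hve : v.proj ∈ e.source) :
    divergence o L Z v = ∑ i, delta e (metricCoeff L e) i (comp e Z i) v
      + ∑ i, ∑ k, christoffel D e v i i k * comp e Z k v := by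
  -- Parallelism is tested on the coordinate frame, where `dVol` is nonzero and can be cancelled; it
  -- then says ℓ(Z) = Γⁱₖᵢ Zᵏ.
  have h := hP e he v hv hve fun i => coordVec e i v.proj
  rw [covForm_volumeForm o hA hL he hv hve, logVolumeDeriv_congr (hN e he v hv hve)] at h
  have h' := sub_eq_zero.1
    ((mul_eq_zero.1 h).resolve_right (volumeForm_frame_ne_zero o hA hL he hv hve))
  rw [divergence_eq o hA hL hZ he hv hve, h', add_comm]
  congr 1
  exact Finset.sum_congr rfl fun i _ => Finset.sum_congr rfl fun k _ => by
    rw [hD.christoffel_symm he hv hve]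

theorem HasMetricConnection.trace_covVec (hN : HasMetricConnection A L D)
    (he : e ∈ IsManifold.maximalAtlas (𝓡 n) ∞ M) (hv : v ∈ A) (hve : v.proj ∈ e.source) :
    LinearMap.trace ℝ (TangentSpace (𝓡 n) v.proj) (covVec e (christoffel D e) Z v)
      = ∑ i, delta e (metricCoeff L e) i (comp e Z i) v
        + ∑ i, ∑ k, christoffel D e v i i k * comp e Z k v := by
  rw [AnisotropicFinsler.trace_covVec he hve]
  simp only [delta_congr (hN e he v hv hve)]

theorem hasMetricConnection_chern (hA : IsConicDomain A) (hL : IsPseudoFinsler A L) :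
    HasMetricConnection A L (chern L) := by
  intro e he v hv hve i j
  rw [← underlyingCoeff_chernSymbol hA hL he hv hve]
  simp only [underlyingCoeff, christoffel_chern hA hL he hv hve]

/-- The factor of ∇_Z(dVol) is ℓ(Z) minus the trace of the Chern symbols against Z, and these agree
by `logVolumeDeriv_metricCoeff`. -/
theorem isParallelAlong_chern (o : OrientedAtlas n M) (hA : IsConicDomain A)
    (hL : IsPseudoFinsler A L) : IsParallelAlong A (chern L) Z (volumeForm o L) := by
  intro e he v hv hve w
  rw [covForm_volumeForm o hA hL he hv hve,
    logVolumeDeriv_congr (hasMetricConnection_chern hA hL e he v hv hve),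
    logVolumeDeriv_metricCoeff hA hL he hv hve]
  simp only [christoffel_chern hA hL he hv hve, sub_self, zero_mul]

end Connection

end Divergence

end AnisotropicFinsler

end

/-! ### The proposition. -/

theorem mainTheorem3 {n : ℕ} (hn : 2 ≤ n)
    {M : Type*} [TopologicalSpace M] [ChartedSpace (EuclideanSpace ℝ (Fin n)) M]
    [IsManifold (𝓡 n) ∞ M] [T2Space M] [SecondCountableTopology M] [ConnectedSpace M]
    (o : AnisotropicFinsler.OrientedAtlas n M)
    (A : Set (TangentBundle (𝓡 n) M)) (hA : AnisotropicFinsler.IsConicDomain A)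
    (L : TangentBundle (𝓡 n) M → ℝ) (hL : AnisotropicFinsler.IsPseudoFinsler A L)
    (Z : ∀ v : TangentBundle (𝓡 n) M, TangentSpace (𝓡 n) v.proj)
    (hZ : AnisotropicFinsler.IsAnisoVectorField A Z) :
    -- `div(Z)` is a well-defined smooth anisotropic function with `𝔩_Z(dVol) = div(Z) dVol`
    (AnisotropicFinsler.IsAnisoFunction A (AnisotropicFinsler.divergence o L Z) ∧
      ∀ e ∈ IsManifold.maximalAtlas (𝓡 n) ∞ M, ∀ v ∈ A, v.proj ∈ e.source → ∀ w,
        AnisotropicFinsler.lieForm e (AnisotropicFinsler.metricCoeff L e) Z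
            (AnisotropicFinsler.volumeForm o L) v w
          = AnisotropicFinsler.divergence o L Z v * AnisotropicFinsler.volumeForm o L v w) ∧
    -- the characterization through any admissible anisotropic connection
    (∀ D, AnisotropicFinsler.IsAnisoConnection A D → AnisotropicFinsler.IsSymmetric A D →
      AnisotropicFinsler.HasMetricConnection A L D →
      AnisotropicFinsler.IsParallelAlong A D Z (AnisotropicFinsler.volumeForm o L) →
      ∀ e ∈ IsManifold.maximalAtlas (𝓡 n) ∞ M, ∀ v ∈ A, v.proj ∈ e.source →
        AnisotropicFinsler.divergence o L Z v
            = LinearMap.trace ℝ (TangentSpace (𝓡 n) v.proj)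
                (AnisotropicFinsler.covVec e (AnisotropicFinsler.christoffel D e) Z v) ∧
        AnisotropicFinsler.divergence o L Z v
            = ∑ i, AnisotropicFinsler.delta e (AnisotropicFinsler.metricCoeff L e) i
                  (AnisotropicFinsler.comp e Z i) v
              + ∑ i, ∑ k, AnisotropicFinsler.christoffel D e v i i k *
                  AnisotropicFinsler.comp e Z k v) ∧
    -- the Chern connection is such a connection, and its symbols are the Chern symbols
    (AnisotropicFinsler.IsAnisoConnection A (AnisotropicFinsler.chern L) ∧
      AnisotropicFinsler.IsSymmetric A (AnisotropicFinsler.chern L) ∧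
      AnisotropicFinsler.HasMetricConnection A L (AnisotropicFinsler.chern L) ∧
      AnisotropicFinsler.IsParallelAlong A (AnisotropicFinsler.chern L) Z
        (AnisotropicFinsler.volumeForm o L) ∧
      ∀ e ∈ IsManifold.maximalAtlas (𝓡 n) ∞ M, ∀ v ∈ A, v.proj ∈ e.source →
        (∀ i j k, AnisotropicFinsler.christoffel (AnisotropicFinsler.chern L) e v i j k
            = AnisotropicFinsler.chernSymbol L e v i j k) ∧
        AnisotropicFinsler.divergence o L Z v
            = LinearMap.trace ℝ (TangentSpace (𝓡 n) v.proj)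
                (AnisotropicFinsler.covVec e
                  (AnisotropicFinsler.christoffel (AnisotropicFinsler.chern L) e) Z v) ∧
        AnisotropicFinsler.divergence o L Z v
            = ∑ i, AnisotropicFinsler.delta e (AnisotropicFinsler.metricCoeff L e) i
                  (AnisotropicFinsler.comp e Z i) v
              + ∑ i, ∑ k, AnisotropicFinsler.chernSymbol L e v i i k *
                  AnisotropicFinsler.comp e Z k v) := by
  open AnisotropicFinsler in
  refine ⟨⟨isAnisoFunction_divergence o hA hL hZ, fun e he v hv hve w =>
      lieForm_volumeForm_eq_divergence o hA hL hZ he hv hve w⟩, ?_,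
    isAnisoConnection_chern hA hL, isSymmetric_chern hA hL, hasMetricConnection_chern hA hL,
    isParallelAlong_chern o hA hL, ?_⟩
  · intro D _ hD hN hP e he v hv hve
    have h := divergence_eq_of_isParallelAlong o hA hL hZ hD hN hP he hv hve
    exact ⟨h.trans (hN.trace_covVec he hv hve).symm, h⟩
  · intro e he v hv hve
    have h := divergence_eq_of_isParallelAlong o hA hL hZ (isSymmetric_chern hA hL)
      (hasMetricConnection_chern hA hL) (isParallelAlong_chern o hA hL) he hv hve
    exact ⟨christoffel_chern hA hL he hv hve,
      h.trans ((hasMetricConnection_chern hA hL).trace_covVec he hv hve).symm,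
      divergence_eq_sum o hA hL hZ he hv hve⟩
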